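/- **Setting.** Let $M=(m_{st})_{s,t\in S}$ be a Coxeter matrix with Coxeter group $W(M)$ and word length $|\cdot|$; write $p_m(s,t)=sts\cdots$ ($m$ letters). A *generalized chamber system* $\mathcal W$ of type $M$ is a directed multigraph (loops allowed) whose vertices are called chambers and whose edges $i$, with initial chamber $\iota(i)$ and terminal chamber $\tau(i)$, have types $\upsilon(i)\in S$, together with, for every $s\in S$, a groupoid $\mathcal W_s$ whose vertices are the chambers and whose non-trivial arrows are the edges of type $s$; the composition in $\mathcal W_s$ is written $i;i'$. A *gallery* is a finite directed edge path, its *type* is the word of its edge types, its *$W$-length* $\gamma_W\in W(M)$ is the product of its type, and it is a *geodesic* if its type is a reduced word. *Weyl data* is a generalized chamber system with, for every pair $s\ne t$ with $m_{st}<\infty$, a set of closed galleries of type $p_{2m_{st}}(s,t)$, the *defining suites*. *Homotopy* of galleries is generated by deleting subgalleries $ii^{-1}$, replacing subgalleries $jj'$ (same type, $j'\neq j^{-1}$) by the edge $j;j'$, deleting defining suites, and the inverses of these moves. A *suite* is a null-homotopic closed gallery of type $p_{2m_{st}}(s,t)$ with $s\ne t$, $m_{st}<\infty$. *Strict homotopy*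 $\simeq$ is generated by replacing a subgallery of type $p_{m_{st}}(s,t)$ ($s\ne t$, $m_{st}<\infty$) by a homotopic one of type $p_{m_{st}}(t,s)$. Weyl data is a *2-Weyl graph* if from every chamber there issues an edge of every type; every gallery of type $p_{m_{st}}(s,t)$ ($s\ne t$, $m_{st}<\infty$) is homotopic to one of type $p_{m_{st}}(t,s)$; and homotopic geodesics with types of the form $p_m(s,t)$ ($s\neq t$, $m_{st}<\infty$, $m\ge 0$) have the same $W$-length. Property (SH): strictly homotopic geodesics of the same type are equal. A *morphism* of generalized chamber systems is a map of chambers and edges that preserves extremities, types, inverses of edges, and the compositions $i;i'$ for $i'\ne i^{-1}$; a morphism of Weyl data must also send defining suites to suites. It is *surjective-étale* if it is surjective on chambers and, for every chamber $D$, bijective from the edges issuing from $D$ to those issuing from the image of $D$. A *covering* is a surjective-étale morphism of Weyl data such that every gallery mapped to a defining suite is a suite; it is connected if its source is. A *pre-covering*, from a generalized chamber system to Weyl data, is a surjective-étale morphism such that every gallery mapped to a defining suite is closed; the *completion* of its source is obtained by taking as defining suites all galleries mapped to defining suites. A *universal cover* is a connected covering $p$ of 2-Weyl graphs such that for every connected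 covering $p'$ of the same 2-Weyl graph there is a morphism $\mu$ of Weyl data with $p=p'\circ\mu$. **Theorem.** Let $\mathcal W$ be a connected 2-Weyl graph of type $M$ with property (SH), and let $C$ be a chamber of $\mathcal W$. Then there is exactly one generalized chamber system $\widetilde{\mathcal W}^C$ of type $M$ such that: * its chambers are the strict homotopy classes $[\gamma]$ of geodesics $\gamma$ in $\mathcal W$ issuing from $C$; * its edges are the pairs $([\gamma],i)$ with $i$ an edge of $\mathcal W$ such that $\iota(i)=\tau(\gamma)$; moreover $\iota([\gamma],i)=[\gamma]$ and $\upsilon([\gamma],i)=\upsilon(i)$; * with $s=\upsilon(i)$ and $w=\gamma_W$: if $|ws|>|w|$, then $\tau([\gamma],i)=[\gamma i]$; if $|ws|<|w|$, then $\tau([\gamma],i)=[\alpha k]$ for any gallery $\alpha$ and edge $j$ of type $s$ with $\alpha j\in[\gamma]$, where $k=j;i$ (and $\alpha k$ means $\alpha$ if $j=i^{-1}$); such $\alpha, j$ exist and the result does not depend on the choices; * if $\upsilon(i)=\upsilon(i')$ and $\tau([\gamma],i)=[\gamma']$, then in the panel groupoid $([\gamma],i);([\gamma'],i')$ is trivial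 if $i'=i^{-1}$, and is $([\gamma],i;i')$ otherwise. Furthermore $p:\widetilde{\mathcal W}^C\to\mathcal W$, $[\gamma]\mapsto\tau(\gamma)$, $([\gamma],i)\mapsto i$, is a pre-covering, and with $\widetilde{\mathcal W}^C$ replaced by its completion with respect to $p$, the covering $p:\widetilde{\mathcal W}^C\to\mathcal W$ is a universal cover of $\mathcal W$. -/

import Mathlib

universe u₀ u₁ u₂ u₃ u₄ u₅ u₆

/-! ### Labeled directed multigraphs and galleries -/

/-- A directed graph (loops and multiple edges allowed) with vertex set `V` and edge set `E`, whose
edges are labeled over `S`. -/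
structure LabeledGraph (S : Type*) (V : Type*) (E : Type*) where
  /-- initial vertex of an edge -/
  ini : E → V
  /-- terminal vertex of an edge -/
  ter : E → V
  /-- type of an edge -/
  typ : E → S

namespace LabeledGraph

variable {S V E : Type*}

/-- The sequence of edges `l` is consecutive and issues from `x`. -/
def IsPath (G : LabeledGraph S V E) : V → List E → Prop
  | _, [] => True
  | x, e :: l => G.ini e = x ∧ G.IsPath (G.ter e) l

/-- The vertex at which a sequence of edges issuing from `x` terminates. -/
def endpoint (G : LabeledGraph S V E) : V → List E → V
  | x, [] => x
  | _, e :: l => G.endpoint (G.ter e) l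

/-- A gallery: an initial vertex together with a consecutive sequence of edges issuing from it. -/
@[ext] structure Gallery (G : LabeledGraph S V E) where
  start : V
  edges : List E
  isPath : G.IsPath start edges

variable {G : LabeledGraph S V E}

namespace Gallery

/-- The terminal vertex of a gallery. -/
def finish (g : G.Gallery) : V := G.endpoint g.start g.edges

/-- The type of a gallery, a word over `S`. -/
def word (g : G.Gallery) : List S := g.edges.map G.typ

def IsCycle (g : G.Gallery) : Prop := g.start = g.finish

end Gallery

/-- The graph is connected: any two vertices are joined by a gallery. -/
def Connected (G : LabeledGraph S V E) : Prop :=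
  ∀ x y : V, ∃ g : G.Gallery, g.start = x ∧ g.finish = y

/-- The arrows from `x` to `y` of a groupoid with vertex set `V` whose non-trivial arrows are the
edges of type `s`: the trivial arrow (only if `x = y`), or an edge of type `s` from `x` to `y`. -/
def PanelHom (G : LabeledGraph S V E) (s : S) (x y : V) :=
  PLift (x = y) ⊕ {e : E // G.typ e = s ∧ G.ini e = x ∧ G.ter e = y}

/-- The trivial arrow at `x`. -/
def PanelHom.one (G : LabeledGraph S V E) (s : S) (x : V) : G.PanelHom s x x := Sum.inl ⟨rfl⟩

/-- An edge as a non-trivial arrow. -/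
def PanelHom.ofEdge (G : LabeledGraph S V E) {s : S} {x y : V} (e : E)
    (h : G.typ e = s ∧ G.ini e = x ∧ G.ter e = y) : G.PanelHom s x y := Sum.inr ⟨e, h⟩

end LabeledGraph

/-! ### Generalized chamber systems -/

/-- A generalized chamber system: a labeled graph such that for each `s`, the vertices together
with the edges of type `s` as the non-trivial arrows carry the structure of a groupoid, the panel
groupoid of type `s`. Composition is written in diagrammatic order. -/
structure GenChamberSystem (S : Type*) (V : Type*) (E : Type*) extends LabeledGraph S V E where
  comp : ∀ {s : S} {x y z : V}, toLabeledGraph.PanelHom s x y → toLabeledGraph.PanelHom s y z →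
    toLabeledGraph.PanelHom s x z
  inv : ∀ {s : S} {x y : V}, toLabeledGraph.PanelHom s x y → toLabeledGraph.PanelHom s y x
  one_comp : ∀ {s : S} {x y : V} (f : toLabeledGraph.PanelHom s x y),
    comp (LabeledGraph.PanelHom.one toLabeledGraph s x) f = f
  comp_one : ∀ {s : S} {x y : V} (f : toLabeledGraph.PanelHom s x y),
    comp f (LabeledGraph.PanelHom.one toLabeledGraph s y) = f
  assoc : ∀ {s : S} {x y z w : V} (f : toLabeledGraph.PanelHom s x y)
    (g : toLabeledGraph.PanelHom s y z) (h : toLabeledGraph.PanelHom s z w),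
    comp (comp f g) h = comp f (comp g h)
  inv_comp : ∀ {s : S} {x y : V} (f : toLabeledGraph.PanelHom s x y),
    comp (inv f) f = LabeledGraph.PanelHom.one toLabeledGraph s y
  comp_inv : ∀ {s : S} {x y : V} (f : toLabeledGraph.PanelHom s x y),
    comp f (inv f) = LabeledGraph.PanelHom.one toLabeledGraph s x

namespace GenChamberSystem

variable {S V E V' E' V'' E'' : Type*}

/-- `i j` is a backtrack: `i` and `j` have the same type, are consecutive, and their composition in
the panel groupoid is trivial, that is, `j = i⁻¹`. -/
def IsBacktrack (W : GenChamberSystem S V E) (i j : E) : Prop :=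
  ∃ (s : S) (x y : V) (hi : W.typ i = s ∧ W.ini i = x ∧ W.ter i = y)
    (hj : W.typ j = s ∧ W.ini j = y ∧ W.ter j = x),
    W.comp (LabeledGraph.PanelHom.ofEdge W.toLabeledGraph i hi)
      (LabeledGraph.PanelHom.ofEdge W.toLabeledGraph j hj) =
      LabeledGraph.PanelHom.one W.toLabeledGraph s x

/-- `i j` is a detour whose composition `i;j` in the panel groupoid is the edge `k`. -/
def IsDetour (W : GenChamberSystem S V E) (i j k : E) : Prop :=
  ∃ (s : S) (x y z : V) (hi : W.typ i = s ∧ W.ini i = x ∧ W.ter i = y)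
    (hj : W.typ j = s ∧ W.ini j = y ∧ W.ter j = z)
    (hk : W.typ k = s ∧ W.ini k = x ∧ W.ter k = z),
    W.comp (LabeledGraph.PanelHom.ofEdge W.toLabeledGraph i hi)
      (LabeledGraph.PanelHom.ofEdge W.toLabeledGraph j hj) =
      LabeledGraph.PanelHom.ofEdge W.toLabeledGraph k hk

/-- A morphism of generalized chamber systems: a morphism of labeled graphs that preserves
inverses of edges and compositions of detours. -/
structure Hom (W : GenChamberSystem S V E) (W' : GenChamberSystem S V' E') where
  obj : V → V'
  edge : E → E'
  ini_edge : ∀ e, W'.ini (edge e) = obj (W.ini e)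
  ter_edge : ∀ e, W'.ter (edge e) = obj (W.ter e)
  typ_edge : ∀ e, W'.typ (edge e) = W.typ e
  map_backtrack : ∀ i j, W.IsBacktrack i j → W'.IsBacktrack (edge i) (edge j)
  map_detour : ∀ i j k, W.IsDetour i j k → W'.IsDetour (edge i) (edge j) (edge k)

namespace Hom

variable {W : GenChamberSystem S V E} {W' : GenChamberSystem S V' E'}

theorem isPath_map (p : Hom W W') (x : V) (l : List E) (h : W.IsPath x l) :
    W'.IsPath (p.obj x) (l.map p.edge) := by
  induction l generalizing x with
  | nil => trivial
  | cons e l ih =>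
    refine ⟨by rw [p.ini_edge, h.1], ?_⟩
    rw [p.ter_edge]
    exact ih _ h.2

/-- The composition `p ∘ g` of a gallery with a morphism. -/
def mapGallery (p : Hom W W') (g : W.Gallery) : W'.Gallery where
  start := p.obj g.start
  edges := g.edges.map p.edge
  isPath := p.isPath_map g.start g.edges g.isPath

theorem word_mapGallery (p : Hom W W') (g : W.Gallery) : (p.mapGallery g).word = g.word := by
  simp [LabeledGraph.Gallery.word, mapGallery, Function.comp_def, p.typ_edge]

/-- `p` is étale and surjective on chambers. -/
def IsSurjectiveEtale (p : Hom W W') : Prop :=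
  (∀ x : V, Set.BijOn p.edge {e | W.ini e = x} {e | W'.ini e = p.obj x}) ∧
    Function.Surjective p.obj

end Hom

end GenChamberSystem

/-! ### Weyl data -/

/-- The alternating word `p_m(s,t) = s t s ⋯` with `m` letters that begins with `s`. -/
def altWord {S : Type*} (s t : S) : ℕ → List S
  | 0 => []
  | m + 1 => s :: altWord t s m

/-- `m_{st}` is finite and `s ≠ t` (in a `CoxeterMatrix`, the entry `0` stands for `∞`). -/
def CoxeterMatrix.IsFinitePair {S : Type*} (M : CoxeterMatrix S) (s t : S) : Prop :=
  s ≠ t ∧ M s t ≠ 0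

/-- An `(s,t)`-cycle: a cycle of type `p_{2 m_{st}}(s,t)`, where `s ≠ t` and `m_{st} < ∞`. -/
def LabeledGraph.IsAltCycle {S V E : Type*} (G : LabeledGraph S V E) (M : CoxeterMatrix S)
    (s t : S) (g : G.Gallery) : Prop :=
  M.IsFinitePair s t ∧ g.IsCycle ∧ g.word = altWord s t (2 * M s t)

/-- Weyl data of type `M`: a generalized chamber system with, for each pair `s ≠ t` with
`m_{st} < ∞`, a set of `(s,t)`-cycles, the defining `(s,t)`-suites. -/
structure WeylData {S : Type*} (M : CoxeterMatrix S) (V : Type*) (E : Type*) extends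
    GenChamberSystem S V E where
  suites : S → S → Set toLabeledGraph.Gallery
  isAltCycle_of_mem : ∀ s t, ∀ g ∈ suites s t, toLabeledGraph.IsAltCycle M s t g

namespace WeylData

variable {S V E V' E' : Type*} {M : CoxeterMatrix S}

section Homotopy

variable (W : WeylData M V E)

/-- The three kinds of contractions of a gallery `g` to a gallery `g'`: deleting a backtrack,
taking a shortcut, deleting a defining suite. -/
inductive Contraction : W.Gallery → W.Gallery → Prop
  | backtrack (g g' : W.Gallery) (l₁ l₂ : List E) (i j : E) (h : W.IsBacktrack i j)
      (hs : g.start = g'.start) (hg : g.edges = l₁ ++ [i, j] ++ l₂)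
      (hg' : g'.edges = l₁ ++ l₂) : Contraction g g'
  | shortcut (g g' : W.Gallery) (l₁ l₂ : List E) (i j k : E) (h : W.IsDetour i j k)
      (hs : g.start = g'.start) (hg : g.edges = l₁ ++ [i, j] ++ l₂)
      (hg' : g'.edges = l₁ ++ [k] ++ l₂) : Contraction g g'
  | suite (g g' : W.Gallery) (l₁ l₂ : List E) (s t : S) (θ : W.Gallery) (h : θ ∈ W.suites s t)
      (hs : g.start = g'.start) (hg : g.edges = l₁ ++ θ.edges ++ l₂)
      (hg' : g'.edges = l₁ ++ l₂) : Contraction g g'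

/-- Homotopy of galleries: a finite sequence of contractions and expansions. -/
def Homotopic : W.Gallery → W.Gallery → Prop := Relation.EqvGen W.Contraction

def NullHomotopic (g : W.Gallery) : Prop := ∃ g₀ : W.Gallery, g₀.edges = [] ∧ W.Homotopic g g₀

/-- An `(s,t)`-suite: a null-homotopic `(s,t)`-cycle. -/
def IsSuite (s t : S) (g : W.Gallery) : Prop := W.IsAltCycle M s t g ∧ W.NullHomotopic g

/-- An elementary strict homotopy replaces a subgallery `ρ` of type `p(s,t)` by a homotopic gallery
`ρ'` of type `p(t,s)`. -/
inductive ElemStrictHomotopy : W.Gallery → W.Gallery → Prop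
  | intro (g g' : W.Gallery) (l₁ l₂ : List E) (s t : S) (hst : M.IsFinitePair s t)
      (ρ ρ' : W.Gallery) (hρ : ρ.word = altWord s t (M s t)) (hρ' : ρ'.word = altWord t s (M t s))
      (h : W.Homotopic ρ ρ') (hs : g.start = g'.start) (hg : g.edges = l₁ ++ ρ.edges ++ l₂)
      (hg' : g'.edges = l₁ ++ ρ'.edges ++ l₂) : ElemStrictHomotopy g g'

/-- Strict homotopy of galleries. -/
def StrictHomotopic : W.Gallery → W.Gallery → Prop := Relation.EqvGen W.ElemStrictHomotopy

/-- The `W`-length of a gallery, an element of the Coxeter group of type `M`. -/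
def wLength (g : W.Gallery) : M.Group := M.toCoxeterSystem.wordProd g.word

/-- A geodesic is a gallery of reduced type. -/
def IsGeodesic (g : W.Gallery) : Prop := M.toCoxeterSystem.IsReduced g.word

/-- An alternating geodesic: a geodesic of type `p_m(s,t)` with `s ≠ t` and `m_{st} < ∞`. -/
def IsAltGeodesic (g : W.Gallery) : Prop :=
  W.IsGeodesic g ∧ ∃ s t m, M.IsFinitePair s t ∧ g.word = altWord s t m

/-- A 2-Weyl graph. In `pw0`, the panel of type `s` containing `x` is the trivial groupoid with one
edge exactly when no edge of type `s` issues from `x`, as edges are the non-trivial arrows. -/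
structure IsTwoWeyl : Prop where
  pw0 : ∀ (x : V) (s : S), ∃ e : E, W.typ e = s ∧ W.ini e = x
  pw1 : ∀ s t, M.IsFinitePair s t → ∀ ρ : W.Gallery, ρ.word = altWord s t (M s t) →
    ∃ ρ' : W.Gallery, ρ'.word = altWord t s (M t s) ∧ W.Homotopic ρ ρ'
  w2 : ∀ g g' : W.Gallery, W.IsAltGeodesic g → W.IsAltGeodesic g' → W.Homotopic g g' →
    W.wLength g = W.wLength g'

/-- Property (SH): strictly homotopic geodesics of the same type are equal. -/
def PropSH : Prop :=
  ∀ g g' : W.Gallery, W.IsGeodesic g → W.IsGeodesic g' → W.StrictHomotopic g g' →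
    g.word = g'.word → g = g'

end Homotopy

/-- A morphism of Weyl data: defining suites are sent to suites. -/
structure Hom (W : WeylData M V E) (W' : WeylData M V' E') extends
    GenChamberSystem.Hom W.toGenChamberSystem W'.toGenChamberSystem where
  map_suite : ∀ s t, ∀ θ ∈ W.suites s t, W'.IsSuite s t (toHom.mapGallery θ)

/-- A covering of Weyl data: a surjective-étale morphism such that galleries that descend to
defining suites are suites. -/
def Hom.IsCovering {W : WeylData M V E} {W' : WeylData M V' E'} (p : Hom W W') : Prop :=
  p.IsSurjectiveEtale ∧
    ∀ s t (g : W.Gallery), p.mapGallery g ∈ W'.suites s t → W.IsSuite s t g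

/-- A universal cover: a connected covering `p` of 2-Weyl graphs such that for every connected
covering `p'` of the same 2-Weyl graph there is a morphism `μ` with `p = p' ∘ μ`. -/
structure IsUniversalCover {S : Type u₀} {M : CoxeterMatrix S}
    {V : Type u₁} {E : Type u₂} {V' : Type u₃} {E' : Type u₄} {W : WeylData M V E}
    {W' : WeylData M V' E'} (p : Hom W W') : Prop where
  source_isTwoWeyl : W.IsTwoWeyl
  target_isTwoWeyl : W'.IsTwoWeyl
  connected : W.Connected
  isCovering : p.IsCovering
  universal : ∀ {V'' : Type u₅} {E'' : Type u₆} (W'' : WeylData M V'' E'') (p' : Hom W'' W'),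
    W''.Connected → p'.IsCovering →
    ∃ μ : Hom W W'', (∀ x, p'.obj (μ.obj x) = p.obj x) ∧ ∀ e, p'.edge (μ.edge e) = p.edge e

/-- A pre-covering of Weyl data by a generalized chamber system: a surjective-étale morphism such
that galleries that descend to defining suites are cycles. -/
def IsPreCovering {G : GenChamberSystem S V' E'} {W : WeylData M V E}
    (p : GenChamberSystem.Hom G W.toGenChamberSystem) : Prop :=
  p.IsSurjectiveEtale ∧ ∀ s t (g : G.Gallery), p.mapGallery g ∈ W.suites s t → g.IsCycle

/-- The completion with respect to a pre-covering `p`: the defining suites are the galleries that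
descend to defining suites. -/
def completion {G : GenChamberSystem S V' E'} {W : WeylData M V E}
    (p : GenChamberSystem.Hom G W.toGenChamberSystem) (hp : IsPreCovering p) :
    WeylData M V' E' where
  toGenChamberSystem := G
  suites s t := {g | p.mapGallery g ∈ W.suites s t}
  isAltCycle_of_mem s t g hg :=
    ⟨(W.isAltCycle_of_mem s t _ hg).1, hp.2 s t g hg, by
      rw [← p.word_mapGallery g]
      exact (W.isAltCycle_of_mem s t _ hg).2.2⟩

theorem isSuite_of_mem (W : WeylData M V E) {s t : S} {θ : W.Gallery} (h : θ ∈ W.suites s t) :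
    W.IsSuite s t θ :=
  ⟨W.isAltCycle_of_mem s t θ h, ⟨θ.start, [], trivial⟩, rfl,
    Relation.EqvGen.rel _ _ (Contraction.suite _ _ [] [] s t θ h rfl (by simp) (by simp))⟩

/-- A pre-covering, as a morphism of Weyl data from the completion. -/
def completionHom {G : GenChamberSystem S V' E'} {W : WeylData M V E}
    (p : GenChamberSystem.Hom G W.toGenChamberSystem) (hp : IsPreCovering p) :
    Hom (completion p hp) W where
  toHom := p
  map_suite _ _ _ hθ := W.isSuite_of_mem hθ

/-! ### Homotopies preserve the extremities of galleries -/

section Extremities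

variable (W : WeylData M V E)

theorem endpoint_append (x : V) (l₁ l₂ : List E) :
    W.endpoint x (l₁ ++ l₂) = W.endpoint (W.endpoint x l₁) l₂ := by
  induction l₁ generalizing x with
  | nil => rfl
  | cons e l ih => exact ih _

theorem isPath_append (x : V) (l₁ l₂ : List E) :
    W.IsPath x (l₁ ++ l₂) ↔ W.IsPath x l₁ ∧ W.IsPath (W.endpoint x l₁) l₂ := by
  induction l₁ generalizing x with
  | nil => simp [LabeledGraph.IsPath, LabeledGraph.endpoint]
  | cons e l ih => simp [LabeledGraph.IsPath, LabeledGraph.endpoint, ih, and_assoc]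

theorem start_eq_of_isPath {x y : V} {l : List E} (hl : l ≠ []) (hx : W.IsPath x l)
    (hy : W.IsPath y l) : x = y := by
  cases l with
  | nil => exact absurd rfl hl
  | cons e l => exact hx.1.symm.trans hy.1

theorem extremities_of_contraction {g g' : W.Gallery} (h : W.Contraction g g') :
    g.start = g'.start ∧ g.finish = g'.finish := by
  cases h with
  | backtrack l₁ l₂ i j h hs hg hg' =>
    refine ⟨hs, ?_⟩
    obtain ⟨s, x, y, hi, hj, -⟩ := h
    have hp := g.isPath
    simp only [hg, List.append_assoc, isPath_append] at hp
    simp only [LabeledGraph.Gallery.finish, hg, hg', endpoint_append, ← hs]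
    have h1 : W.ini i = W.endpoint g.start l₁ := hp.2.1.1
    simp only [LabeledGraph.endpoint, hj.2.2, ← h1, hi.2.1]
  | shortcut l₁ l₂ i j k h hs hg hg' =>
    refine ⟨hs, ?_⟩
    obtain ⟨s, x, y, z, hi, hj, hk, -⟩ := h
    simp only [LabeledGraph.Gallery.finish, hg, hg', endpoint_append, ← hs]
    simp only [LabeledGraph.endpoint, hj.2.2, hk.2.2]
  | suite l₁ l₂ s t θ h hs hg hg' =>
    refine ⟨hs, ?_⟩
    have hp := g.isPath
    simp only [hg, List.append_assoc, isPath_append] at hp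
    simp only [LabeledGraph.Gallery.finish, hg, hg', endpoint_append, ← hs]
    congr 1
    have hc := (W.isAltCycle_of_mem s t θ h).2.1
    by_cases hθ : θ.edges = []
    · simp [hθ, LabeledGraph.endpoint]
    · have := W.start_eq_of_isPath hθ hp.2.1 θ.isPath
      rw [this]
      exact hc.symm

theorem extremities_of_homotopic {g g' : W.Gallery} (h : W.Homotopic g g') :
    g.start = g'.start ∧ g.finish = g'.finish := by
  induction h with
  | rel _ _ h => exact W.extremities_of_contraction h
  | refl _ => exact ⟨rfl, rfl⟩
  | symm _ _ _ ih => exact ⟨ih.1.symm, ih.2.symm⟩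
  | trans _ _ _ _ _ ih₁ ih₂ => exact ⟨ih₁.1.trans ih₂.1, ih₁.2.trans ih₂.2⟩

theorem edges_ne_nil {g : W.Gallery} {s t : S} (hst : M.IsFinitePair s t)
    (h : g.word = altWord s t (M s t)) : g.edges ≠ [] := by
  intro h0
  obtain ⟨m, hm⟩ := Nat.exists_eq_succ_of_ne_zero hst.2
  simp [LabeledGraph.Gallery.word, h0, hm, altWord] at h

theorem extremities_of_elemStrictHomotopy {g g' : W.Gallery} (h : W.ElemStrictHomotopy g g') :
    g.start = g'.start ∧ g.finish = g'.finish := by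
  obtain ⟨l₁, l₂, s, t, hst, ρ, ρ', hρ, hρ', h, hs, hg, hg'⟩ := h
  refine ⟨hs, ?_⟩
  have hp := g.isPath
  simp only [hg, List.append_assoc, isPath_append] at hp
  simp only [LabeledGraph.Gallery.finish, hg, hg', endpoint_append, ← hs]
  congr 1
  rw [W.start_eq_of_isPath (W.edges_ne_nil hst hρ) hp.2.1 ρ.isPath]
  rw [(W.extremities_of_homotopic h).1]
  have := (W.extremities_of_homotopic h).2
  simp only [LabeledGraph.Gallery.finish, (W.extremities_of_homotopic h).1] at this
  exact this

theorem extremities_of_strictHomotopic {g g' : W.Gallery} (h : W.StrictHomotopic g g') :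
    g.start = g'.start ∧ g.finish = g'.finish := by
  induction h with
  | rel _ _ h => exact W.extremities_of_elemStrictHomotopy h
  | refl _ => exact ⟨rfl, rfl⟩
  | symm _ _ _ ih => exact ⟨ih.1.symm, ih.2.symm⟩
  | trans _ _ _ _ _ ih₁ ih₂ => exact ⟨ih₁.1.trans ih₂.1, ih₁.2.trans ih₂.2⟩

end Extremities

/-! ### The graph of strict homotopy classes of geodesics issuing from a chamber `C` -/

section StrictHomotopyGraph

variable (W : WeylData M V E) (C : V)

/-- The geodesics issuing from `C`. -/
def GeodesicFrom := {g : W.Gallery // W.IsGeodesic g ∧ g.start = C}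

instance geodesicFromSetoid : Setoid (W.GeodesicFrom C) where
  r g g' := W.StrictHomotopic g.1 g'.1
  iseqv := ⟨fun _ => Relation.EqvGen.refl _, fun h => Relation.EqvGen.symm _ _ h,
    fun h h' => Relation.EqvGen.trans _ _ _ h h'⟩

/-- The chambers: strict homotopy classes `[γ]` of geodesics `γ` issuing from `C`. -/
def ClassFrom := Quotient (W.geodesicFromSetoid C)

variable {W C}

/-- The class `[γ]`. -/
def GeodesicFrom.cls (γ : W.GeodesicFrom C) : W.ClassFrom C := Quotient.mk _ γ

/-- The chamber of `W` at which the geodesics of a class terminate. -/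
def ClassFrom.finish (a : W.ClassFrom C) : V :=
  Quotient.lift (fun γ : W.GeodesicFrom C => γ.1.finish)
    (fun _ _ h => (W.extremities_of_strictHomotopic h).2) a

variable (W C)

/-- The edges: pairs `([γ], i)` where `i` is an edge of `W` issuing from the chamber at which `[γ]`
terminates. -/
def EdgeFrom := {x : W.ClassFrom C × E // W.ini x.2 = x.1.finish}

variable {W C}

/-- The relation `τ([γ], i) = b`. Let `s` be the type of `i` and `w` the `W`-length of `γ`.
If `w s > w`, then `τ([γ], i) = [γ i]`. If `w s < w`, then `τ([γ], i) = [α k]`, where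
`α j ∈ [γ]`, the type of `j` is `s`, and `k = j;i`; if `j = i⁻¹`, then `k` is trivial and
`[α k]` means `[α]`. (In the Bruhat order, `w s < w` holds exactly if `s` is a right descent
of `w`, and `w s > w` otherwise.) -/
inductive IsTerminal : W.ClassFrom C → E → W.ClassFrom C → Prop
  | up (γ γi : W.GeodesicFrom C) (i : E)
      (hs : ¬ M.toCoxeterSystem.IsRightDescent (W.wLength γ.1) (W.typ i))
      (hi : γi.1.edges = γ.1.edges ++ [i]) : IsTerminal γ.cls i γi.cls
  | downTrivial (γ α αj : W.GeodesicFrom C) (i j : E)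
      (hs : M.toCoxeterSystem.IsRightDescent (W.wLength γ.1) (W.typ i))
      (hj : αj.1.edges = α.1.edges ++ [j]) (hγ : αj.cls = γ.cls)
      (hk : W.IsBacktrack j i) : IsTerminal γ.cls i α.cls
  | down (γ α αj αk : W.GeodesicFrom C) (i j k : E)
      (hs : M.toCoxeterSystem.IsRightDescent (W.wLength γ.1) (W.typ i))
      (hj : αj.1.edges = α.1.edges ++ [j]) (hγ : αj.cls = γ.cls)
      (hk : W.IsDetour j i k) (hαk : αk.1.edges = α.1.edges ++ [k]) :
      IsTerminal γ.cls i αk.cls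

/-- The generalized chamber system `G` on the chambers `[γ]` and the edges `([γ], i)` has the
prescribed extremities, types and panel groupoids: `ι([γ], i) = [γ]`, `τ([γ], i)` as in
`IsTerminal`, the type of `([γ], i)` is that of `i`, and if `τ([γ], i) = [γ']`, then the composition
of `([γ], i)` and `([γ'], i')` is trivial if `i' = i⁻¹`, and is `([γ], i;i')` otherwise. -/
structure IsStrictHomotopySystem (G : GenChamberSystem S (W.ClassFrom C) (W.EdgeFrom C)) :
    Prop where
  ini_eq : ∀ x : W.EdgeFrom C, G.ini x = x.1.1
  ter_eq_iff : ∀ (x : W.EdgeFrom C) (b : W.ClassFrom C), G.ter x = b ↔ IsTerminal x.1.1 x.1.2 b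
  typ_eq : ∀ x : W.EdgeFrom C, G.typ x = W.typ x.1.2
  backtrack : ∀ x y : W.EdgeFrom C, G.ter x = y.1.1 → W.IsBacktrack x.1.2 y.1.2 →
    G.IsBacktrack x y
  detour : ∀ x y z : W.EdgeFrom C, G.ter x = y.1.1 → z.1.1 = x.1.1 →
    W.IsDetour x.1.2 y.1.2 z.1.2 → G.IsDetour x y z

end StrictHomotopyGraph

end WeylData

/-! In a 2-Weyl graph every braid move of types is realized by a strict homotopy. With Matsumoto's
theorem (`reflTransGen_braidMove`), a geodesic can therefore be re-typed by any reduced word of its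
W-length, and (SH) then allows a last edge of common type to be cancelled
(`StrictFrom.of_append_singleton`). Hence, for each s, a class is [l f] in an essentially unique
way: the W-length of l has no right descent s, and f is a possibly trivial arrow of the s-panel
(`exists_normalForm`, `normalForm_unique`). The prescribed terminal chamber is obtained by composing
f with the edge, so the panel groupoids of W act on the classes. The required system is the action
groupoid, with its étale projection; a groupoid structure is determined by its backtracks and
detours, which gives uniqueness.

The pre-covering property says that defining suites act trivially
(`foldl_classAct_of_homotopicFrom_nil`). Write a class as [ηβ], where the W-length of η has no right
descents in {s,t} and β is alternating. A null-homotopic {s,t}-gallery θ sends it to [ηρ], where ρ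
is an alternating geodesic homotopic to βθ, hence to β. By `w2`, ρ and β have the same W-length, and
(SH) makes them strictly homotopic.

For universality, coverings lift homotopies. Given a covering and a chamber c over C, lifting
geodesics from c sends each class to a well-defined chamber, and the action on classes is itself
realized by homotopies, so this is a morphism.

The input on Coxeter groups is that the product of two generators has order exactly m (geometric
representation), the exchange condition (action on W × ZMod 2), Matsumoto's theorem, and the
splitting of an element relative to {s,t} (`exists_append_altWord`). -/

namespace CoxeterSystem

open Polynomial.Chebyshev

variable {B : Type*} {M : CoxeterMatrix B} {W : Type*} [Group W] (cs : CoxeterSystem M W)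

/-! ### The geometric representation -/

/-- The linear form `v ↦ 2⟨α_i, v⟩` of the geometric representation. -/
noncomputable def geomForm (M : CoxeterMatrix B) (i : B) : Module.Dual ℝ (B →₀ ℝ) :=
  -- For m = ∞ the entry is 0, and π / 0 = 0 gives the intended coefficient -2.
  Finsupp.linearCombination ℝ fun j => -2 * Real.cos (Real.pi / M i j)

theorem geomForm_single (M : CoxeterMatrix B) (i j : B) :
    geomForm M i (Finsupp.single j 1) = -2 * Real.cos (Real.pi / M i j) := by
  simp [geomForm]

theorem geomForm_self (M : CoxeterMatrix B) (i : B) :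
    geomForm M i (Finsupp.single i 1) = 2 := by
  simp [geomForm_single]

/-- The reflection by which the generator `i` acts in the geometric representation. -/
noncomputable def geomReflection (M : CoxeterMatrix B) (i : B) : (B →₀ ℝ) ≃ₗ[ℝ] (B →₀ ℝ) :=
  Module.reflection (geomForm_self M i)

theorem three_le_of_ne {i j : B} (hij : i ≠ j) (h0 : M i j ≠ 0) (h2 : M i j ≠ 2) :
    3 ≤ M i j := by
  have := M.off_diagonal i j hij
  omega

theorem geomForm_mul_sub_two (i j : B) :
    geomForm M i (Finsupp.single j 1) * geomForm M j (Finsupp.single i 1) - 2 =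
      2 * Real.cos (2 * (Real.pi / M i j)) := by
  rw [geomForm_single, geomForm_single, M.symmetric j i, Real.cos_two_mul]
  ring

theorem sin_two_pi_div_ne_zero {m : ℕ} (hm : 3 ≤ m) : Real.sin (2 * (Real.pi / m)) ≠ 0 := by
  have h3 : (3 : ℝ) ≤ m := by exact_mod_cast hm
  have hpi := Real.pi_pos
  refine (Real.sin_pos_of_pos_of_lt_pi (by positivity) ?_).ne'
  have : Real.pi / m ≤ Real.pi / 3 := by gcongr
  linarith

/-- Powers of a product of two reflections are expressed by Chebyshev polynomials S at 2 cos θ with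
θ = 2π/m. Since S_n(2 cos θ) sin θ = sin((n+1)θ), the relation reduces to identities between sines.
The case m = 2 is separate because sin θ = 0 there. -/
theorem geomReflection_isLiftable : M.IsLiftable (geomReflection M) := by
  intro i j
  by_cases hij : i = j
  · subst hij
    simp only [M.diagonal, pow_one]
    ext1 v
    exact Module.involutive_reflection (geomForm_self M i) v
  by_cases h0 : M i j = 0
  · simp [h0]
  by_cases h2 : M i j = 2
  · have e1 : geomForm M i (Finsupp.single j 1) = 0 := by simp [geomForm_single, h2]
    have e2 : geomForm M j (Finsupp.single i 1) = 0 := by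
      simp [geomForm_single, M.symmetric j i, h2]
    rw [h2, pow_two]
    refine LinearEquiv.ext fun v => ?_
    simp only [LinearEquiv.mul_apply, geomReflection, Module.reflection_apply, map_sub, map_smul,
      geomForm_self, e1, e2, LinearEquiv.coe_one, id]
    module
  have h3 := three_le_of_ne hij h0 h2
  have hs := sin_two_pi_div_ne_zero h3
  set θ := 2 * (Real.pi / M i j) with hθ
  have hmθ : (M i j : ℝ) * θ = 2 * Real.pi := by
    rw [hθ]
    field_simp
  have key : ∀ n : ℤ, (S ℝ n).eval (2 * Real.cos θ) * Real.sin θ = Real.sin ((n + 1) * θ) :=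
    fun n => S_two_mul_real_cos θ n
  refine LinearEquiv.ext fun v => ?_
  rw [geomReflection, geomReflection, Module.reflection_mul_reflection_pow_apply
    (geomForm_self M i) (geomForm_self M j) (M i j) v _ (geomForm_mul_sub_two i j).symm, ← hθ]
  -- The indices in the formula are halves. For m = 2k, kθ = π kills S_(k-1); for m = 2k+1, (k+1)θ =
  -- 2π - kθ kills S_k + S_(k-1).
  rcases Nat.even_or_odd' (M i j) with ⟨k, hk | hk⟩
  · have h1 : (((M i j : ℕ) : ℤ) - 2) / 2 = (k : ℤ) - 1 := by omega
    have h4 : (((M i j : ℕ) : ℤ) - 1) / 2 = (k : ℤ) - 1 := by omega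
    have hz : (S ℝ ((k : ℤ) - 1)).eval (2 * Real.cos θ) = 0 := by
      have := key ((k : ℤ) - 1)
      have e : ((((k : ℤ) - 1 : ℤ) : ℝ) + 1) * θ = Real.pi := by
        rw [hk] at hmθ
        push_cast at hmθ ⊢
        linarith
      rw [e, Real.sin_pi] at this
      exact (mul_eq_zero.1 this).resolve_right hs
    rw [h1, h4, hz]
    simp
  · have h1 : (((M i j : ℕ) : ℤ) - 2) / 2 = (k : ℤ) - 1 := by omega
    have h4 : (((M i j : ℕ) : ℤ) - 1) / 2 = (k : ℤ) := by omega
    have h5 : (((M i j : ℕ) : ℤ) - 3) / 2 = (k : ℤ) - 1 := by omega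
    have h6 : ((M i j : ℕ) : ℤ) / 2 = (k : ℤ) := by omega
    have hz : (S ℝ (k : ℤ)).eval (2 * Real.cos θ) + (S ℝ ((k : ℤ) - 1)).eval (2 * Real.cos θ)
        = 0 := by
      have a := key (k : ℤ)
      have b := key ((k : ℤ) - 1)
      have e : (((k : ℤ) : ℝ) + 1) * θ = 2 * Real.pi - ((((k : ℤ) - 1 : ℤ) : ℝ) + 1) * θ := by
        rw [hk] at hmθ
        push_cast at hmθ ⊢
        linarith
      rw [e, Real.sin_two_pi_sub, ← b] at a
      refine (mul_eq_zero.1 (?_ : _ * Real.sin θ = 0)).resolve_right hs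
      linarith
    rw [h1, h4, h5, h6, hz]
    simp

/-- If the power fixed α_i, comparing coefficients would give S_(d-1) = 0 and S_d = 1 when m ≥ 3,
that is, sin dθ = 0 and cos dθ = 1, so that m divides d. For m = ∞ the value S_(d-1)(2) = d is not
zero. -/
theorem geomReflection_mul_pow_ne_one {i j : B} (hij : i ≠ j) {d : ℕ} (hd : 0 < d)
    (hM : d < M i j ∨ M i j = 0) : (geomReflection M i * geomReflection M j) ^ d ≠ 1 := by
  intro h
  have h1 := congrArg (fun g : (B →₀ ℝ) ≃ₗ[ℝ] (B →₀ ℝ) => g (Finsupp.single i 1)) h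
  simp only [geomReflection, Module.reflection_mul_reflection_pow_apply_self (geomForm_self M i)
    (geomForm_self M j) d _ (geomForm_mul_sub_two i j).symm, LinearEquiv.coe_one, id] at h1
  have hi := DFunLike.congr_fun h1 i
  have hj := DFunLike.congr_fun h1 j
  simp only [Finsupp.add_apply, Finsupp.smul_apply, smul_eq_mul, Finsupp.single_eq_same,
    Finsupp.single_eq_of_ne hij, Finsupp.single_eq_of_ne hij.symm, mul_one, mul_zero, add_zero,
    zero_add] at hi hj
  by_cases h0 : M i j = 0
  · simp only [h0, Nat.cast_zero, div_zero, mul_zero, Real.cos_zero, mul_one, geomForm_single,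
      M.symmetric j i, S_eval_two] at hj
    have : (d : ℝ) ≠ 0 := by positivity
    push_cast at hj
    apply this
    linarith
  have hdM := hM.resolve_right h0
  by_cases h2 : M i j = 2
  · obtain rfl : d = 1 := by omega
    simp only [h2] at hi
    norm_num at hi
    rw [show 2 * (Real.pi / 2) = Real.pi by ring, Real.cos_pi] at hi
    norm_num at hi
  have h3 := three_le_of_ne hij h0 h2
  have hs := sin_two_pi_div_ne_zero h3
  have h3' : (3 : ℝ) ≤ M i j := by exact_mod_cast h3
  have hpi := Real.pi_pos
  have hcos : geomForm M j (Finsupp.single i 1) ≠ 0 := by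
    rw [geomForm_single, M.symmetric j i]
    have h4 : Real.pi / M i j ≤ Real.pi / 3 := by gcongr
    have h5 : 0 ≤ Real.pi / M i j := by positivity
    have := Real.cos_pos_of_mem_Ioo (x := Real.pi / M i j) ⟨by linarith, by linarith⟩
    linarith
  have hS := (mul_eq_zero.1 hj).resolve_right (neg_ne_zero.2 hcos)
  rw [hS, add_zero] at hi
  have a := S_two_mul_real_cos (2 * (Real.pi / M i j)) (d : ℤ)
  have b := S_two_mul_real_cos (2 * (Real.pi / M i j)) ((d : ℤ) - 1)
  rw [hi, one_mul] at a
  rw [hS, zero_mul] at b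
  push_cast at a b
  rw [sub_add_cancel] at b
  rw [add_mul, one_mul, Real.sin_add, ← b, zero_mul, zero_add] at a
  have hc : Real.cos (d * (2 * (Real.pi / M i j))) = 1 := by
    have := mul_right_cancel₀ hs ((one_mul _).trans a)
    exact this.symm
  rw [Real.cos_eq_one_iff] at hc
  obtain ⟨n, hn⟩ := hc
  have hn' : (n : ℝ) * M i j = d := by
    field_simp at hn
    linarith
  have hn2 : n * (M i j : ℤ) = d := by exact_mod_cast hn'
  have hn0 : 0 < n := by
    by_contra hle
    nlinarith [show (0 : ℤ) < M i j by omega, show (0 : ℤ) < d by omega]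
  nlinarith [show (d : ℤ) < M i j by omega]

theorem simple_mul_simple_pow_ne_one {i j : B} (hij : i ≠ j) {d : ℕ} (hd : 0 < d)
    (hM : d < M i j ∨ M i j = 0) : (cs.simple i * cs.simple j) ^ d ≠ 1 := by
  intro h
  have := congrArg (cs.lift ⟨_, geomReflection_isLiftable⟩) h
  rw [map_pow, map_mul, lift_apply_simple, lift_apply_simple, map_one] at this
  exact geomReflection_mul_pow_ne_one hij hd hM this

end CoxeterSystem

namespace CoxeterSystem

variable {B : Type*} {M : CoxeterMatrix B} {W : Type*} [Group W] (cs : CoxeterSystem M W)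

/-! ### The exchange condition -/

open Classical in
/-- The action of the generator `i` on `W × ZMod 2` that records whether `i` inverts an element. -/
noncomputable def inversionAct (i : B) : Function.End (W × ZMod 2) :=
  fun x => (cs.simple i * x.1 * cs.simple i, x.2 + if x.1 = cs.simple i then 1 else 0)

theorem simple_mul_pow_conj (i j : B) (r : ℕ) :
    cs.simple j * (cs.simple i * cs.simple j) ^ r =
      ((cs.simple i * cs.simple j) ^ r)⁻¹ * cs.simple j := by
  induction r with
  | zero => simp
  | succ r ih =>
    rw [pow_succ (cs.simple i * cs.simple j), ← mul_assoc, ih, ← pow_succ, pow_succ']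
    simp [mul_assoc]

open Classical in
theorem inversionAct_mul_pow (i j : B) (n : ℕ) (x : W × ZMod 2) :
    ((cs.inversionAct i * cs.inversionAct j) ^ n) x =
      ((cs.simple i * cs.simple j) ^ n * x.1 * ((cs.simple i * cs.simple j) ^ n)⁻¹,
        x.2 + ∑ r ∈ Finset.range (2 * n),
          if x.1 = cs.simple j * (cs.simple i * cs.simple j) ^ r then 1 else 0) := by
  induction n with
  | zero =>
    simp only [pow_zero, mul_zero, Finset.range_zero, Finset.sum_empty, inv_one, one_mul, mul_one,
      add_zero]
    rfl
  | succ n ih =>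
    rw [pow_succ']
    change cs.inversionAct i (cs.inversionAct j (((cs.inversionAct i * cs.inversionAct j) ^ n) x)) =
      _
    rw [ih]
    set c := cs.simple i * cs.simple j with hc
    have hcj : (cs.simple j) * c ^ n = (c ^ n)⁻¹ * cs.simple j := cs.simple_mul_pow_conj i j n
    have e1 : c ^ n * x.1 * (c ^ n)⁻¹ = cs.simple j ↔ x.1 = cs.simple j * c ^ (2 * n) := by
      rw [two_mul, pow_add, ← mul_assoc, hcj, mul_inv_eq_iff_eq_mul, ← eq_inv_mul_iff_mul_eq,
        mul_assoc]
    have e2 : cs.simple j * (c ^ n * x.1 * (c ^ n)⁻¹) * cs.simple j = cs.simple i ↔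
        x.1 = cs.simple j * c ^ (2 * n + 1) := by
      have : cs.simple j * c ^ (2 * n + 1) = (c ^ n)⁻¹ * (cs.simple j * c) * c ^ n := by
        rw [show 2 * n + 1 = n + 1 + n by ring, pow_add, pow_add, pow_one, ← mul_assoc, ← mul_assoc,
          hcj]
        simp only [mul_assoc]
      rw [this]
      constructor
      · intro h
        rw [show cs.simple j * c = cs.simple j * cs.simple i * cs.simple j from
          (mul_assoc _ _ _).symm, ← h]
        simp [mul_assoc]
      · intro h
        rw [h, hc]
        simp [mul_assoc]
    rw [show 2 * (n + 1) = 2 * n + 1 + 1 by ring, Finset.sum_range_succ, Finset.sum_range_succ]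
    simp only [inversionAct, e1, e2, pow_succ' c n]
    refine Prod.ext ?_ ?_
    · simp [hc, mul_assoc]
    · simp only [add_assoc]

/-- The 2m reflections s_j (s_i s_j)^r repeat with period m, so each is counted an even number of
times. -/
theorem inversionAct_isLiftable : M.IsLiftable cs.inversionAct := by
  classical
  intro i j
  funext x
  rw [inversionAct_mul_pow, simple_mul_simple_pow, two_mul, Finset.sum_range_add]
  simp only [pow_add, simple_mul_simple_pow, one_mul]
  rw [CharTwo.add_self_eq_zero]
  simp only [inv_one, mul_one, add_zero]
  rfl

-- The left side depends only on the group element, so the parity with which a reflection occurs in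
-- the inversion sequence does not depend on the word.
open Classical in
theorem lift_inversionAct_wordProd (ω : List B) (x : W × ZMod 2) :
    cs.lift ⟨_, cs.inversionAct_isLiftable⟩ (cs.wordProd ω) x =
      (cs.wordProd ω * x.1 * (cs.wordProd ω)⁻¹, x.2 + ((cs.rightInvSeq ω).count x.1 : ℕ)) := by
  induction ω with
  | nil =>
    simp only [wordProd_nil, map_one, one_mul, inv_one, mul_one, rightInvSeq_nil, List.count_nil,
      Nat.cast_zero, add_zero]
    rfl
  | cons i ω ih =>
    rw [wordProd_cons, map_mul, lift_apply_simple]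
    change cs.inversionAct i (cs.lift ⟨_, cs.inversionAct_isLiftable⟩ (cs.wordProd ω) x) = _
    rw [ih]
    simp only [inversionAct, rightInvSeq, List.count_cons, mul_inv_rev, inv_simple, mul_assoc]
    refine Prod.ext rfl ?_
    have : cs.wordProd ω * (x.1 * (cs.wordProd ω)⁻¹) = cs.simple i ↔
        (cs.wordProd ω)⁻¹ * (cs.simple i * cs.wordProd ω) = x.1 := by
      rw [← mul_assoc, mul_inv_eq_iff_eq_mul, inv_mul_eq_iff_eq_mul, eq_comm]
    simp only [this, beq_iff_eq]
    push_cast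
    rw [add_assoc]

/-- The exchange condition; ω need not be reduced. Passing from w to ws flips the parity attached to
s. If s were absent for ω, it would occur for a reduced word of ws and thus be a descent of both w
and ws. -/
theorem simple_mem_rightInvSeq {ω : List B} {i : B} (h : cs.IsRightDescent (cs.wordProd ω) i) :
    cs.simple i ∈ cs.rightInvSeq ω := by
  classical
  by_contra hn
  obtain ⟨ω', hω', hw⟩ := cs.exists_isReduced (cs.wordProd ω * cs.simple i)
  have h1 := cs.lift_inversionAct_wordProd ω (cs.simple i, 1)
  have h2 := cs.lift_inversionAct_wordProd ω' (cs.simple i, 0)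
  rw [← hw, map_mul, lift_apply_simple] at h2
  change cs.lift ⟨_, cs.inversionAct_isLiftable⟩ (cs.wordProd ω)
    (cs.inversionAct i (cs.simple i, 0)) = _ at h2
  have h3 : cs.inversionAct i (cs.simple i, 0) = (cs.simple i, 1) := by simp [inversionAct]
  rw [h3, h1, List.count_eq_zero_of_not_mem hn] at h2
  have h4 := congrArg Prod.snd h2
  by_cases hm : cs.simple i ∈ cs.rightInvSeq ω'
  · have := (cs.isRightInversion_of_mem_rightInvSeq hω' hm).2
    rw [← hw, simple_mul_simple_cancel_right] at this
    exact absurd h (by unfold IsRightDescent; omega)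
  · rw [List.count_eq_zero_of_not_mem hm] at h4
    simp at h4

/-- Multiplication by the n-th entry of the inversion sequence deletes the n-th letter. -/
theorem exists_wordProd_eq_mul_of_mem_rightInvSeq {ω : List B} {t : W}
    (h : t ∈ cs.rightInvSeq ω) :
    ∃ ω' : List B, ω'.length + 1 = ω.length ∧ cs.wordProd ω' = cs.wordProd ω * t := by
  obtain ⟨n, hn, rfl⟩ := List.getElem_of_mem h
  refine ⟨ω.eraseIdx n, ?_, ?_⟩
  · rw [length_rightInvSeq] at hn
    rw [List.length_eraseIdx_of_lt hn]
    omega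
  · rw [← wordProd_mul_getD_rightInvSeq, List.getD_eq_getElem _ _ hn]

theorem mem_rightInvSeq_append {a b : List B} {t : W} (h : t ∈ cs.rightInvSeq (a ++ b)) :
    cs.wordProd b * t * (cs.wordProd b)⁻¹ ∈ cs.rightInvSeq a ∨ t ∈ cs.rightInvSeq b := by
  induction a with
  | nil => exact Or.inr h
  | cons i a ih =>
    rw [List.cons_append, rightInvSeq, List.mem_cons] at h
    rcases h with rfl | h
    · left
      rw [rightInvSeq, wordProd_append]
      simp [mul_assoc]
    · exact (ih h).imp_left fun h => List.mem_cons_of_mem _ h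

theorem exists_eq_of_mem_rightInvSeq_alternatingWord {n : ℕ} {i j : B} {t : W}
    (h : t ∈ cs.rightInvSeq (alternatingWord j i n)) :
    ∃ r < n, t = cs.simple i * (cs.simple j * cs.simple i) ^ r := by
  induction n generalizing i j t with
  | zero => simp [alternatingWord] at h
  | succ n ih =>
    rw [alternatingWord_succ, rightInvSeq_concat, List.concat_eq_append, List.mem_append,
      List.mem_map, List.mem_singleton] at h
    rcases h with ⟨t', ht', rfl⟩ | rfl
    · obtain ⟨r, hr, rfl⟩ := ih ht'
      refine ⟨r + 1, by omega, ?_⟩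
      rw [MulAut.conj_apply, inv_simple, ← mul_pow_mul, pow_succ]
      simp only [mul_assoc]
    · exact ⟨0, by omega, by simp⟩

/-- A generator does not belong to the inversions of a short alternating word ending with the other
generator. -/
theorem simple_notMem_rightInvSeq_alternatingWord {n : ℕ} {i j : B} (hij : i ≠ j)
    (hn : n < M i j ∨ M i j = 0) : cs.simple j ∉ cs.rightInvSeq (alternatingWord j i n) := by
  intro h
  obtain ⟨r, hr, h⟩ := cs.exists_eq_of_mem_rightInvSeq_alternatingWord h
  -- From s_j = s_i (s_j s_i)^r follows (s_j s_i)^(r+1) = 1, although 0 < r+1 ≤ n is below the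
  -- order.
  refine cs.simple_mul_simple_pow_ne_one hij.symm (d := r + 1) (by omega) ?_ ?_
  · rw [M.symmetric j i]
    omega
  · rw [pow_succ', mul_assoc, ← h, simple_mul_simple_self]

theorem isReduced_of_wordProd_eq {ω ω' : List B} (h : cs.IsReduced ω)
    (hp : cs.wordProd ω = cs.wordProd ω') (hl : ω.length = ω'.length) : cs.IsReduced ω' := by
  rw [IsReduced, ← hp, ← hl]
  exact h

theorem length_eq_of_isReduced {ω ω' : List B} (h : cs.IsReduced ω) (h' : cs.IsReduced ω')
    (hp : cs.wordProd ω = cs.wordProd ω') : ω.length = ω'.length := by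
  rw [← h.eq, ← h'.eq, hp]

/-- The tail grows by exchange. Given a tail that is to be extended by j, the descent j is an
inversion of the whole word but not of the tail, so the deleted letter lies in η and j can be
appended without changing the length. -/
theorem exists_alternatingWord_suffix {x : W} {i j : B} (hij : i ≠ j)
    (hi : cs.IsRightDescent x i) (hj : cs.IsRightDescent x j) (n : ℕ)
    (hn : n ≤ M i j ∨ M i j = 0) :
    ∃ η : List B, cs.IsReduced (η ++ alternatingWord i j n) ∧
      x = cs.wordProd (η ++ alternatingWord i j n) := by
  induction n generalizing i j with
  | zero =>
    obtain ⟨η, h1, h2⟩ := cs.exists_isReduced x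
    exact ⟨η, by simpa [alternatingWord] using h1, by simpa [alternatingWord] using h2⟩
  | succ n ih =>
    obtain ⟨η, h1, rfl⟩ := ih hij.symm hj hi (by rw [M.symmetric j i]; omega)
    have hm := (cs.mem_rightInvSeq_append (cs.simple_mem_rightInvSeq hj)).resolve_right
      (cs.simple_notMem_rightInvSeq_alternatingWord hij (by omega))
    obtain ⟨η', hl, hp⟩ := cs.exists_wordProd_eq_mul_of_mem_rightInvSeq hm
    have hx : cs.wordProd (η ++ alternatingWord j i n) =
        cs.wordProd (η' ++ alternatingWord i j (n + 1)) := by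
      rw [alternatingWord_succ, List.concat_eq_append, wordProd_append, wordProd_append,
        wordProd_append, hp]
      simp [mul_assoc]
    refine ⟨η', cs.isReduced_of_wordProd_eq h1 hx ?_, hx⟩
    simp only [List.length_append, length_alternatingWord]
    omega

/-- For m = ∞ a reduced word of x could have a tail longer than x. -/
theorem ne_zero_of_isRightDescent {x : W} {i j : B} (hij : i ≠ j)
    (hi : cs.IsRightDescent x i) (hj : cs.IsRightDescent x j) : M i j ≠ 0 := by
  intro h0
  obtain ⟨η, h1, h2⟩ := cs.exists_alternatingWord_suffix hij hi hj (cs.length x + 1) (Or.inr h0)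
  have := h1.eq
  rw [← h2, List.length_append, length_alternatingWord] at this
  omega

/-! ### Reduced words and right descents -/

theorem isReduced_append_left {a b : List B} (h : cs.IsReduced (a ++ b)) : cs.IsReduced a := by
  simpa using h.take a.length

theorem isReduced_append_right {a b : List B} (h : cs.IsReduced (a ++ b)) : cs.IsReduced b := by
  simpa using h.drop a.length

theorem isRightDescent_append_singleton {a : List B} {i : B} (h : cs.IsReduced (a ++ [i])) :
    cs.IsRightDescent (cs.wordProd (a ++ [i])) i := by
  rw [IsRightDescent, h.eq, wordProd_append, wordProd_singleton, simple_mul_simple_cancel_right,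
    (cs.isReduced_append_left h).eq]
  simp

theorem isReduced_append_singleton_iff {a : List B} (h : cs.IsReduced a) {i : B} :
    cs.IsReduced (a ++ [i]) ↔ ¬ cs.IsRightDescent (cs.wordProd a) i := by
  rw [not_isRightDescent_iff, IsReduced, wordProd_append, wordProd_singleton, h.eq]
  simp

theorem exists_isReduced_append_singleton {x : W} {i : B} (h : cs.IsRightDescent x i) :
    ∃ a, cs.IsReduced (a ++ [i]) ∧ cs.wordProd (a ++ [i]) = x := by
  obtain ⟨a, ha, hx⟩ := cs.exists_isReduced (x * cs.simple i)
  have h2 : cs.wordProd (a ++ [i]) = x := by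
    rw [wordProd_append, ← hx, wordProd_singleton, simple_mul_simple_cancel_right]
  refine ⟨a, ?_, h2⟩
  rw [cs.isReduced_append_singleton_iff ha, ← hx, ← isRightDescent_iff_not_isRightDescent_mul]
  exact h

/-! ### Alternating words -/

theorem alternatingWord_eq_ite (i j : B) (n : ℕ) :
    alternatingWord i j n = if Even n then altWord i j n else altWord j i n := by
  induction n with
  | zero => rfl
  | succ n ih =>
    rw [alternatingWord_succ', ih]
    by_cases h : Even n <;> simp [h, Nat.even_add_one, altWord]

theorem altWord_eq_ite (i j : B) (n : ℕ) :
    altWord i j n = if Even n then alternatingWord i j n else alternatingWord j i n := by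
  rw [alternatingWord_eq_ite, alternatingWord_eq_ite]
  split_ifs <;> rfl

theorem length_altWord (i j : B) (n : ℕ) : (altWord i j n).length = n := by
  induction n generalizing i j with
  | zero => rfl
  | succ n ih => simp [altWord, ih]

theorem mem_altWord {n : ℕ} {i j k : B} (h : k ∈ altWord i j n) : k = i ∨ k = j := by
  induction n generalizing i j with
  | zero => simp [altWord] at h
  | succ n ih =>
    rcases List.mem_cons.1 h with rfl | h
    exacts [Or.inl rfl, (ih h).symm]

theorem alternatingWord_add (i j : B) (k n : ℕ) :
    ∃ a b, (a = i ∧ b = j ∨ a = j ∧ b = i) ∧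
      alternatingWord i j (k + n) = alternatingWord a b k ++ alternatingWord i j n := by
  induction n generalizing i j with
  | zero => exact ⟨i, j, Or.inl ⟨rfl, rfl⟩, by simp [alternatingWord]⟩
  | succ n ih =>
    obtain ⟨a, b, h, e⟩ := ih j i
    refine ⟨a, b, h.symm, ?_⟩
    rw [← add_assoc, alternatingWord_succ, e, alternatingWord_succ]
    simp

theorem altWord_prefix (i j : B) {n m : ℕ} (h : n ≤ m) : ∃ l, altWord i j m = altWord i j n ++ l := by
  induction n generalizing i j m with
  | zero => exact ⟨_, rfl⟩
  | succ n ih =>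
    obtain ⟨m, rfl⟩ := Nat.exists_eq_add_of_le' h
    obtain ⟨l, hl⟩ := ih j i (m := m + n) (by omega)
    exact ⟨l, by rw [← add_assoc, altWord, hl]; rfl⟩

theorem isReduced_alternatingWord {i j : B} (hij : i ≠ j) {n : ℕ} (hn : n ≤ M i j ∨ M i j = 0) :
    cs.IsReduced (alternatingWord i j n) := by
  induction n generalizing i j with
  | zero => simp [alternatingWord, IsReduced]
  | succ n ih =>
    have h := ih hij.symm (by rw [M.symmetric j i]; omega)
    rw [alternatingWord_succ, List.concat_eq_append, cs.isReduced_append_singleton_iff h]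
    exact fun hd => cs.simple_notMem_rightInvSeq_alternatingWord hij (by omega)
      (cs.simple_mem_rightInvSeq hd)

theorem isReduced_altWord {i j : B} (hij : i ≠ j) {n : ℕ} (hn : n ≤ M i j ∨ M i j = 0) :
    cs.IsReduced (altWord i j n) := by
  rw [altWord_eq_ite]
  split_ifs
  · exact cs.isReduced_alternatingWord hij hn
  · exact cs.isReduced_alternatingWord hij.symm (by rwa [M.symmetric j i])

/-- If `η` has no right descents in `{i, j}`, then an alternating word of length less than `m_ij`
after `η` has only one right descent in `{i, j}`. -/
theorem le_of_isRightDescent_append_alternatingWord {η : List B} {i j : B} (hij : i ≠ j)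
    (hi : ¬ cs.IsRightDescent (cs.wordProd η) i) (hj : ¬ cs.IsRightDescent (cs.wordProd η) j)
    {n : ℕ} (hn : n ≠ 0) (hr : cs.IsReduced (η ++ alternatingWord i j n))
    (hd : cs.IsRightDescent (cs.wordProd (η ++ alternatingWord i j n)) i) : M i j ≤ n := by
  by_contra hlt
  obtain ⟨k, hk⟩ := Nat.exists_eq_add_of_lt (not_le.1 hlt)
  have hd' : cs.IsRightDescent (cs.wordProd (η ++ alternatingWord i j n)) j := by
    obtain ⟨n, rfl⟩ := Nat.exists_eq_succ_of_ne_zero hn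
    rw [alternatingWord_succ, List.concat_eq_append, ← List.append_assoc] at hr ⊢
    exact cs.isRightDescent_append_singleton hr
  -- Both generators are descents, so there is a reduced word with an alternating tail of length m >
  -- n. Cancelling its last n letters exhibits a word for the element of η that ends in i or j.
  obtain ⟨η', h1, h2⟩ := cs.exists_alternatingWord_suffix hij hd hd' (M i j) (Or.inl le_rfl)
  obtain ⟨a, b, hab, e⟩ := alternatingWord_add i j (k + 1) n
  rw [show M i j = k + 1 + n by omega, e, ← List.append_assoc] at h1 h2
  have h3 : cs.wordProd η = cs.wordProd (η' ++ alternatingWord a b (k + 1)) := by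
    rw [wordProd_append, wordProd_append] at h2
    exact mul_right_cancel h2
  have h4 := cs.isReduced_append_left h1
  rw [alternatingWord_succ, List.concat_eq_append, ← List.append_assoc] at h3 h4
  have h5 := cs.isRightDescent_append_singleton h4
  rw [← h3] at h5
  rcases hab with ⟨rfl, rfl⟩ | ⟨rfl, rfl⟩
  exacts [hj h5, hi h5]

/-- Every element factors as one without right descents in `{i, j}` and an alternating word. -/
theorem exists_append_altWord {i j : B} (x : W) :
    ∃ (η : List B) (a b : B) (n : ℕ), (a = i ∧ b = j ∨ a = j ∧ b = i) ∧
      cs.IsReduced (η ++ altWord a b n) ∧ cs.wordProd (η ++ altWord a b n) = x ∧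
      ¬ cs.IsRightDescent (cs.wordProd η) i ∧ ¬ cs.IsRightDescent (cs.wordProd η) j := by
  classical
  -- The alternating tail is chosen as long as possible; a right descent of η in {i, j} would
  -- lengthen it.
  let P : ℕ → Prop := fun n => ∃ (η : List B) (a b : B), (a = i ∧ b = j ∨ a = j ∧ b = i) ∧
      cs.IsReduced (η ++ altWord a b n) ∧ cs.wordProd (η ++ altWord a b n) = x
  have hb : ∀ n, P n → n ≤ cs.length x := by
    rintro n ⟨η, a, b, -, h, rfl⟩
    rw [h.eq, List.length_append, length_altWord]
    omega
  have h0 : P 0 := by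
    obtain ⟨η, h1, h2⟩ := cs.exists_isReduced x
    exact ⟨η, i, j, Or.inl ⟨rfl, rfl⟩, by simpa [altWord] using h1, by simpa [altWord] using h2.symm⟩
  obtain ⟨η, a, b, hab, hr, hx⟩ := Nat.findGreatest_spec (Nat.zero_le (cs.length x)) h0
  set n := Nat.findGreatest P (cs.length x) with hn
  have hmax : ∀ c, (c = i ∨ c = j) → ¬ cs.IsRightDescent (cs.wordProd η) c := by
    intro c hc hd
    obtain ⟨η', h1, h2⟩ := cs.exists_isReduced_append_singleton hd
    suffices P (n + 1) by
      have := Nat.le_findGreatest (hb _ this) this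
      omega
    have h3 : cs.wordProd (η ++ altWord a b n) = cs.wordProd (η' ++ ([c] ++ altWord a b n)) := by
      rw [← List.append_assoc, wordProd_append, wordProd_append, h2]
    have h4 : η.length = (η' ++ [c]).length :=
      cs.length_eq_of_isReduced (cs.isReduced_append_left hr) h1 h2.symm
    have h5 := cs.isReduced_of_wordProd_eq hr h3 (by
      simp only [List.length_append] at h4 ⊢
      omega)
    rw [h3] at hx
    -- If c were the first letter of a nonempty tail, a reduced word would contain c c.
    have hcb : c = b ∨ n = 0 := by
      by_contra hne
      push Not at hne
      obtain ⟨k, hk⟩ := Nat.exists_eq_succ_of_ne_zero hne.2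
      have hca : c = a := by
        rcases hab with ⟨rfl, rfl⟩ | ⟨rfl, rfl⟩ <;> tauto
      have h6 := cs.isReduced_append_right h5
      rw [hk, hca, altWord, ← List.singleton_append (l := altWord b a k), ← List.append_assoc] at h6
      have h7 := (cs.isReduced_append_left h6).eq
      simp [wordProd_cons] at h7
    have hdef : ∀ d, altWord c d (n + 1) = [c] ++ altWord d c n := fun d => rfl
    rcases hcb with rfl | h0
    · exact ⟨η', c, a, hab.symm.imp And.symm And.symm, by rwa [hdef], by rwa [hdef]⟩
    · rw [h0] at h5 hx ⊢
      rcases hc with rfl | rfl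
      · exact ⟨η', c, j, Or.inl ⟨rfl, rfl⟩, h5, hx⟩
      · exact ⟨η', c, i, Or.inr ⟨rfl, rfl⟩, h5, hx⟩
  exact ⟨η, a, b, n, hab, hr, hx, hmax i (Or.inl rfl), hmax j (Or.inr rfl)⟩

/-! ### Matsumoto's theorem -/

/-- A braid move replaces a subword `p(s,t)` by `p(t,s)`. -/
inductive BraidMove (M : CoxeterMatrix B) : List B → List B → Prop
  | intro (l₁ l₂ : List B) (s t : B) (h : M.IsFinitePair s t) :
    BraidMove M (l₁ ++ altWord s t (M s t) ++ l₂) (l₁ ++ altWord t s (M t s) ++ l₂)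

theorem wordProd_altWord_comm (s t : B) :
    cs.wordProd (altWord s t (M s t)) = cs.wordProd (altWord t s (M t s)) := by
  have h := cs.wordProd_braidWord_eq s t
  rw [braidWord, braidWord, M.symmetric t s] at h
  rw [altWord_eq_ite, altWord_eq_ite, M.symmetric t s]
  split_ifs
  exacts [h, h.symm]

theorem BraidMove.append_right {ω ω' : List B} (h : BraidMove M ω ω') (l : List B) :
    BraidMove M (ω ++ l) (ω' ++ l) := by
  obtain ⟨l₁, l₂, s, t, h⟩ := h
  simpa using BraidMove.intro l₁ (l₂ ++ l) s t h

theorem braidMove_alternatingWord {i j : B} (h : M.IsFinitePair i j) (η : List B) :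
    BraidMove M (η ++ alternatingWord j i (M j i)) (η ++ alternatingWord i j (M i j)) := by
  have h' : M.IsFinitePair j i := ⟨h.1.symm, by rw [M.symmetric j i]; exact h.2⟩
  rw [alternatingWord_eq_ite, alternatingWord_eq_ite, M.symmetric j i]
  split_ifs
  · simpa [M.symmetric j i] using BraidMove.intro η [] j i h'
  · simpa [M.symmetric j i] using BraidMove.intro η [] i j h

/-- Matsumoto's theorem: reduced words of the same element are related by braid moves. -/
theorem reflTransGen_braidMove {ω ω' : List B} (h : cs.IsReduced ω) (h' : cs.IsReduced ω')
    (hp : cs.wordProd ω = cs.wordProd ω') : Relation.ReflTransGen (BraidMove M) ω ω' := by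
  have hlen := cs.length_eq_of_isReduced h h' hp
  induction hn : ω.length generalizing ω ω' with
  | zero =>
    rw [List.length_eq_zero_iff.1 hn, List.length_eq_zero_iff.1 (hlen.symm.trans hn)]
  | succ n ih =>
    -- A common last letter is cancelled and the induction hypothesis applied.
    have step : ∀ {a b : List B} {i : B}, cs.IsReduced (a ++ [i]) → cs.IsReduced (b ++ [i]) →
        cs.wordProd (a ++ [i]) = cs.wordProd (b ++ [i]) → (a ++ [i]).length = n + 1 →
        Relation.ReflTransGen (BraidMove M) (a ++ [i]) (b ++ [i]) := by
      intro a b i ha hb hab hl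
      have hab' : cs.wordProd a = cs.wordProd b := by
        rw [wordProd_append, wordProd_append] at hab
        exact mul_right_cancel hab
      have ha' := cs.isReduced_append_left ha
      have hb' := cs.isReduced_append_left hb
      have := ih ha' hb' hab' (cs.length_eq_of_isReduced ha' hb' hab') (by simpa using hl)
      exact this.lift (· ++ [i]) fun _ _ h => h.append_right [i]
    obtain rfl | ⟨a, i, rfl⟩ := List.eq_nil_or_concat' ω
    · simp at hn
    obtain rfl | ⟨b, j, rfl⟩ := List.eq_nil_or_concat' ω'
    · simp at hlen
    by_cases hij : i = j
    · subst hij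
      exact step h h' hp hn
    have hi := cs.isRightDescent_append_singleton h
    have hj := cs.isRightDescent_append_singleton h'
    rw [← hp] at hj
    have h0 := cs.ne_zero_of_isRightDescent hij hi hj
    obtain ⟨m, hm⟩ := Nat.exists_eq_succ_of_ne_zero h0
    -- Distinct last letters i, j are both descents, so the element has reduced words with the two
    -- full alternating tails. They differ by one braid move, and each shares its last letter with
    -- one of the given words.
    obtain ⟨η, h1, h2⟩ := cs.exists_alternatingWord_suffix hij hi hj (M i j) (Or.inl le_rfl)
    have hbr := braidMove_alternatingWord (M := M) ⟨hij, h0⟩ η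
    have h3 : cs.wordProd (η ++ alternatingWord j i (M j i)) =
        cs.wordProd (η ++ alternatingWord i j (M i j)) := by
      rw [wordProd_append, wordProd_append]
      exact congrArg _ (cs.wordProd_braidWord_eq j i)
    have h4 := cs.isReduced_of_wordProd_eq h1 h3.symm (by
      simp [length_alternatingWord, M.symmetric j i])
    rw [← h2] at h3
    have hl1 := cs.length_eq_of_isReduced h h4 h3.symm
    have hl2 := cs.length_eq_of_isReduced h h1 h2
    have hmj : M j i = m + 1 := by rw [M.symmetric j i, hm]
    rw [hmj, alternatingWord_succ, List.concat_eq_append, ← List.append_assoc] at h3 h4 hbr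
    rw [hm, Nat.succ_eq_add_one, alternatingWord_succ, List.concat_eq_append,
      ← List.append_assoc] at h1 h2 hbr hl2
    exact ((step h h4 h3.symm hn).tail hbr).trans
      (step h1 h' (h2.symm.trans hp) (hl2.symm.trans hn))

end CoxeterSystem

namespace WeylData

variable {S V E : Type*} {M : CoxeterMatrix S} (W : WeylData M V E)

/-! ### Homotopy of paths with a common initial chamber -/

/-- Homotopy of two sequences of edges that issue from `x`. -/
def HomotopicFrom (x : V) (l l' : List E) : Prop :=
  ∃ (h : W.IsPath x l) (h' : W.IsPath x l'), W.Homotopic ⟨x, l, h⟩ ⟨x, l', h'⟩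

/-- Strict homotopy of two sequences of edges that issue from `x`. -/
def StrictFrom (x : V) (l l' : List E) : Prop :=
  ∃ (h : W.IsPath x l) (h' : W.IsPath x l'), W.StrictHomotopic ⟨x, l, h⟩ ⟨x, l', h'⟩

/-- Compatibility with concatenation, shared by both kinds of homotopy. An empty list of edges does
not determine its chamber, so `hstart` is needed for the intermediate galleries to fit between a and
b. -/
theorem eqvGen_sandwich {R : W.Gallery → W.Gallery → Prop}
    (hext : ∀ g g', R g g' → g.start = g'.start ∧ g.finish = g'.finish)
    (hR : ∀ (g g' h h' : W.Gallery) (a b : List E), R g g' → h.start = h'.start →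
      h.edges = a ++ g.edges ++ b → h'.edges = a ++ g'.edges ++ b → R h h')
    {g g' : W.Gallery} (hg : Relation.EqvGen R g g') {h h' : W.Gallery} {a b : List E}
    (hs : h.start = h'.start) (he : h.edges = a ++ g.edges ++ b)
    (he' : h'.edges = a ++ g'.edges ++ b) (hstart : W.endpoint h.start a = g.start) :
    Relation.EqvGen R h h' := by
  have ext : ∀ {g g'}, Relation.EqvGen R g g' → g.start = g'.start ∧ g.finish = g'.finish := by
    intro g g' h
    induction h with
    | rel _ _ h => exact hext _ _ h
    | refl _ => exact ⟨rfl, rfl⟩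
    | symm _ _ _ ih => exact ⟨ih.1.symm, ih.2.symm⟩
    | trans _ _ _ _ _ ih₁ ih₂ => exact ⟨ih₁.1.trans ih₂.1, ih₁.2.trans ih₂.2⟩
  induction hg generalizing h h' with
  | rel _ _ r => exact .rel _ _ (hR _ _ _ _ a b r hs he he')
  | refl _ =>
    have : h = h' := LabeledGraph.Gallery.ext hs (he.trans he'.symm)
    exact this ▸ .refl _
  | symm _ _ r ih => exact .symm _ _ (ih hs.symm he' he (by rw [← hs, hstart, (ext r).1]))
  | trans g₁ g₂ g₃ r₁ r₂ ih₁ ih₂ =>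
    have hp := h.isPath
    rw [he, isPath_append, isPath_append, endpoint_append, hstart] at hp
    have e1 := (ext r₁).1
    have e2 := (ext r₁).2
    have hp' : W.IsPath h.start (a ++ g₂.edges ++ b) := by
      rw [isPath_append, isPath_append, endpoint_append, hstart, e1]
      refine ⟨⟨hp.1.1, g₂.isPath⟩, ?_⟩
      have := hp.2
      change W.IsPath g₁.finish b at this
      rw [e2] at this
      exact this
    exact .trans _ ⟨h.start, _, hp'⟩ _ (ih₁ rfl he rfl hstart) (ih₂ hs rfl he' (hstart.trans e1))

theorem Contraction.sandwich {g g' h h' : W.Gallery} {a b : List E} (r : W.Contraction g g')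
    (hs : h.start = h'.start) (he : h.edges = a ++ g.edges ++ b)
    (he' : h'.edges = a ++ g'.edges ++ b) : W.Contraction h h' := by
  cases r with
  | backtrack l₁ l₂ i j hb _ hg hg' =>
    exact .backtrack _ _ (a ++ l₁) (l₂ ++ b) i j hb hs (by simp [he, hg]) (by simp [he', hg'])
  | shortcut l₁ l₂ i j k hb _ hg hg' =>
    exact .shortcut _ _ (a ++ l₁) (l₂ ++ b) i j k hb hs (by simp [he, hg]) (by simp [he', hg'])
  | suite l₁ l₂ s t θ hb _ hg hg' =>
    exact .suite _ _ (a ++ l₁) (l₂ ++ b) s t θ hb hs (by simp [he, hg]) (by simp [he', hg'])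

theorem ElemStrictHomotopy.sandwich {g g' h h' : W.Gallery} {a b : List E}
    (r : W.ElemStrictHomotopy g g') (hs : h.start = h'.start) (he : h.edges = a ++ g.edges ++ b)
    (he' : h'.edges = a ++ g'.edges ++ b) : W.ElemStrictHomotopy h h' := by
  obtain ⟨l₁, l₂, s, t, hst, ρ, ρ', hρ, hρ', hh, -, hg, hg'⟩ := r
  exact .intro _ _ (a ++ l₁) (l₂ ++ b) s t hst ρ ρ' hρ hρ' hh hs (by simp [he, hg])
    (by simp [he', hg'])

theorem Homotopic.sandwich {g g' : W.Gallery} (hg : W.Homotopic g g') {h h' : W.Gallery}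
    {a b : List E} (hs : h.start = h'.start) (he : h.edges = a ++ g.edges ++ b)
    (he' : h'.edges = a ++ g'.edges ++ b) (hstart : W.endpoint h.start a = g.start) :
    W.Homotopic h h' :=
  W.eqvGen_sandwich (fun _ _ => W.extremities_of_contraction)
    (fun _ _ _ _ _ _ r => Contraction.sandwich W r) hg hs he he' hstart

theorem StrictHomotopic.homotopic {g g' : W.Gallery} (h : W.StrictHomotopic g g') :
    W.Homotopic g g' := by
  induction h with
  | rel g g' h =>
    obtain ⟨l₁, l₂, s, t, hst, ρ, ρ', hρ, hρ', hh, hs, hg, hg'⟩ := h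
    refine Homotopic.sandwich W hh hs hg hg' ?_
    have hp := g.isPath
    rw [hg, List.append_assoc, isPath_append, isPath_append] at hp
    exact W.start_eq_of_isPath (W.edges_ne_nil hst hρ) hp.2.1 ρ.isPath
  | refl _ => exact .refl _
  | symm _ _ _ ih => exact .symm _ _ ih
  | trans _ _ _ _ _ ih₁ ih₂ => exact .trans _ _ _ ih₁ ih₂

variable {W} {x : V} {l l' l'' a b : List E}

namespace HomotopicFrom

theorem refl (h : W.IsPath x l) : W.HomotopicFrom x l l := ⟨h, h, .refl _⟩

theorem symm : W.HomotopicFrom x l l' → W.HomotopicFrom x l' l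
  | ⟨h, h', r⟩ => ⟨h', h, .symm _ _ r⟩

theorem trans : W.HomotopicFrom x l l' → W.HomotopicFrom x l' l'' → W.HomotopicFrom x l l''
  | ⟨h, _, r⟩, ⟨_, h'', r'⟩ => ⟨h, h'', .trans _ _ _ r r'⟩

theorem endpoint_eq : W.HomotopicFrom x l l' → W.endpoint x l = W.endpoint x l'
  | ⟨_, _, r⟩ => (W.extremities_of_homotopic r).2

theorem append_right (h : W.HomotopicFrom x l l') (hb : W.IsPath (W.endpoint x l) b) :
    W.HomotopicFrom x (l ++ b) (l' ++ b) := by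
  have he := h.endpoint_eq
  obtain ⟨h, h', r⟩ := h
  exact ⟨(W.isPath_append _ _ _).2 ⟨h, hb⟩, (W.isPath_append _ _ _).2 ⟨h', he ▸ hb⟩,
    Homotopic.sandwich W (a := []) (b := b) r rfl rfl rfl rfl⟩

theorem append_left (ha : W.IsPath x a) (h : W.HomotopicFrom (W.endpoint x a) l l') :
    W.HomotopicFrom x (a ++ l) (a ++ l') := by
  obtain ⟨h, h', r⟩ := h
  exact ⟨(W.isPath_append _ _ _).2 ⟨ha, h⟩, (W.isPath_append _ _ _).2 ⟨ha, h'⟩,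
    Homotopic.sandwich W (a := a) (b := []) r rfl (by simp) (by simp) rfl⟩

end HomotopicFrom

/-! ### Strict homotopy of geodesics -/

theorem wLength_eq_of_elemStrictHomotopy {g g' : W.Gallery} (h : W.ElemStrictHomotopy g g') :
    W.wLength g = W.wLength g' ∧ g.word.length = g'.word.length := by
  obtain ⟨l₁, l₂, s, t, hst, ρ, ρ', hρ, hρ', -, -, hg, hg'⟩ := h
  have e1 : g.word = l₁.map W.typ ++ altWord s t (M s t) ++ l₂.map W.typ := by
    rw [← hρ]
    simp [LabeledGraph.Gallery.word, hg]
  have e2 : g'.word = l₁.map W.typ ++ altWord t s (M t s) ++ l₂.map W.typ := by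
    rw [← hρ']
    simp [LabeledGraph.Gallery.word, hg']
  constructor
  · simp only [wLength, e1, e2, CoxeterSystem.wordProd_append]
    rw [CoxeterSystem.wordProd_altWord_comm]
  · simp [e1, e2, CoxeterSystem.length_altWord, M.symmetric t s]

theorem wLength_eq_of_strictHomotopic {g g' : W.Gallery} (h : W.StrictHomotopic g g') :
    W.wLength g = W.wLength g' ∧ g.word.length = g'.word.length := by
  induction h with
  | rel _ _ h => exact wLength_eq_of_elemStrictHomotopy h
  | refl _ => exact ⟨rfl, rfl⟩
  | symm _ _ _ ih => exact ⟨ih.1.symm, ih.2.symm⟩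
  | trans _ _ _ _ _ ih₁ ih₂ => exact ⟨ih₁.1.trans ih₂.1, ih₁.2.trans ih₂.2⟩

variable (W) in
/-- The type of a sequence of edges is reduced. -/
abbrev RedWord (l : List E) : Prop := M.toCoxeterSystem.IsReduced (l.map W.typ)

variable (W) in
/-- The product of the type of a sequence of edges in the Coxeter group. -/
abbrev wProd (l : List E) : M.Group := M.toCoxeterSystem.wordProd (l.map W.typ)

namespace StrictFrom

theorem refl (h : W.IsPath x l) : W.StrictFrom x l l := ⟨h, h, .refl _⟩

theorem symm : W.StrictFrom x l l' → W.StrictFrom x l' l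
  | ⟨h, h', r⟩ => ⟨h', h, .symm _ _ r⟩

theorem trans : W.StrictFrom x l l' → W.StrictFrom x l' l'' → W.StrictFrom x l l''
  | ⟨h, _, r⟩, ⟨_, h'', r'⟩ => ⟨h, h'', .trans _ _ _ r r'⟩

theorem homotopicFrom : W.StrictFrom x l l' → W.HomotopicFrom x l l'
  | ⟨h, h', r⟩ => ⟨h, h', StrictHomotopic.homotopic W r⟩

theorem endpoint_eq (h : W.StrictFrom x l l') : W.endpoint x l = W.endpoint x l' :=
  h.homotopicFrom.endpoint_eq

theorem wProd_eq : W.StrictFrom x l l' → W.wProd l = W.wProd l'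
  | ⟨_, _, r⟩ => (wLength_eq_of_strictHomotopic r).1

theorem length_eq : W.StrictFrom x l l' → l.length = l'.length
  | ⟨_, _, r⟩ => by simpa [LabeledGraph.Gallery.word] using (wLength_eq_of_strictHomotopic r).2

theorem redWord (h : W.StrictFrom x l l') (hr : W.RedWord l) : W.RedWord l' :=
  CoxeterSystem.isReduced_of_wordProd_eq _ hr h.wProd_eq (by simpa using h.length_eq)

theorem append_right (h : W.StrictFrom x l l') (hb : W.IsPath (W.endpoint x l) b) :
    W.StrictFrom x (l ++ b) (l' ++ b) := by
  have he := h.endpoint_eq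
  obtain ⟨h, h', r⟩ := h
  exact ⟨(W.isPath_append _ _ _).2 ⟨h, hb⟩, (W.isPath_append _ _ _).2 ⟨h', he ▸ hb⟩,
    W.eqvGen_sandwich (fun _ _ => W.extremities_of_elemStrictHomotopy)
    (fun _ _ _ _ _ _ r => ElemStrictHomotopy.sandwich W r) (a := []) (b := b) r rfl rfl rfl rfl⟩

theorem append_left (ha : W.IsPath x a) (h : W.StrictFrom (W.endpoint x a) l l') :
    W.StrictFrom x (a ++ l) (a ++ l') := by
  obtain ⟨h, h', r⟩ := h
  exact ⟨(W.isPath_append _ _ _).2 ⟨ha, h⟩, (W.isPath_append _ _ _).2 ⟨ha, h'⟩,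
    W.eqvGen_sandwich (fun _ _ => W.extremities_of_elemStrictHomotopy)
    (fun _ _ _ _ _ _ r => ElemStrictHomotopy.sandwich W r) (a := a) (b := []) r rfl
    (by simp) (by simp) rfl⟩

/-- Property (SH) for sequences of edges. -/
theorem eq (hSH : W.PropSH) (h : W.StrictFrom x l l') (hr : W.RedWord l)
    (ht : l.map W.typ = l'.map W.typ) : l = l' := by
  have hr' := h.redWord hr
  obtain ⟨h, h', r⟩ := h
  exact congrArg LabeledGraph.Gallery.edges (hSH ⟨x, l, h⟩ ⟨x, l', h'⟩ hr hr' r ht)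

end StrictFrom

/-- Homotopic sequences of types `p(s,t)` and `p(t,s)` are strictly homotopic. -/
theorem HomotopicFrom.strictFrom {s t : S} (hst : M.IsFinitePair s t)
    (h : W.HomotopicFrom x l l') (hl : l.map W.typ = altWord s t (M s t))
    (hl' : l'.map W.typ = altWord t s (M t s)) : W.StrictFrom x l l' := by
  obtain ⟨h, h', r⟩ := h
  exact ⟨h, h', 
    .rel _ _ (.intro _ _ [] [] s t hst ⟨x, l, h⟩ ⟨x, l', h'⟩ hl hl' r rfl (by simp) (by simp))⟩

/-- In a 2-Weyl graph, a sequence of type `p(s,t)` is strictly homotopic to one of type `p(t,s)`. -/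
theorem IsTwoWeyl.exists_strictFrom_altWord (hW : W.IsTwoWeyl) {s t : S}
    (hst : M.IsFinitePair s t) (h : W.IsPath x l) (hl : l.map W.typ = altWord s t (M s t)) :
    ∃ l', W.StrictFrom x l l' ∧ l'.map W.typ = altWord t s (M t s) := by
  obtain ⟨ρ', hρ', hh⟩ := hW.pw1 s t hst ⟨x, l, h⟩ hl
  obtain ⟨y, l', h'⟩ := ρ'
  obtain rfl : x = y := (W.extremities_of_homotopic hh).1
  exact ⟨l', HomotopicFrom.strictFrom hst ⟨h, h', hh⟩ hl hρ', hρ'⟩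

theorem IsTwoWeyl.exists_strictFrom_braidMove (hW : W.IsTwoWeyl) {ω : List S}
    (h : W.IsPath x l) (hm : CoxeterSystem.BraidMove M (l.map W.typ) ω) :
    ∃ l', W.StrictFrom x l l' ∧ l'.map W.typ = ω := by
  generalize hω : l.map W.typ = ω₀ at hm
  obtain ⟨l₁, l₂, s, t, hst⟩ := hm
  obtain ⟨ab, c, rfl, hab, hc⟩ := List.map_eq_append_iff.1 hω
  obtain ⟨a, b, rfl, ha, hb⟩ := List.map_eq_append_iff.1 hab
  rw [isPath_append, isPath_append] at h
  obtain ⟨b', hb', hbt⟩ := hW.exists_strictFrom_altWord hst h.1.2 hb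
  exact ⟨a ++ b' ++ c, (hb'.append_left h.1.1).append_right h.2, by simp [ha, hc, hbt]⟩

/-- Matsumoto's theorem lifted to galleries: each braid move of the type is realized by `pw1`. -/
theorem IsTwoWeyl.exists_strictFrom (hW : W.IsTwoWeyl) {ω : List S} (h : W.IsPath x l)
    (hr : W.RedWord l) (hω : M.toCoxeterSystem.IsReduced ω)
    (hp : W.wProd l = M.toCoxeterSystem.wordProd ω) :
    ∃ l', W.StrictFrom x l l' ∧ l'.map W.typ = ω := by
  have := CoxeterSystem.reflTransGen_braidMove _ hr hω hp
  clear hω hp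
  induction this with
  | refl => exact ⟨l, .refl h, rfl⟩
  | tail _ hm ih =>
    obtain ⟨l₁, h₁, rfl⟩ := ih
    obtain ⟨l₂, h₂, e⟩ := hW.exists_strictFrom_braidMove h₁.2.1 hm
    exact ⟨l₂, h₁.trans h₂, e⟩

/-- Strictly homotopic geodesics whose last edges have the same type have the same last edge and
strictly homotopic initial parts. -/
theorem StrictFrom.of_append_singleton (hW : W.IsTwoWeyl) (hSH : W.PropSH) {i j : E}
    (h : W.StrictFrom x (a ++ [i]) (b ++ [j])) (hr : W.RedWord (a ++ [i]))
    (ht : W.typ i = W.typ j) : W.StrictFrom x a b ∧ i = j := by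
  have hr' := h.redWord hr
  have hpa := ((W.isPath_append _ _ _).1 h.1)
  have hpb := ((W.isPath_append _ _ _).1 h.2.1)
  have hw := h.wProd_eq
  simp only [wProd, List.map_append, List.map_cons, List.map_nil,
    CoxeterSystem.wordProd_append, ht] at hw
  rw [RedWord, List.map_append] at hr hr'
  -- Once b is re-typed by the type of a, the two whole galleries have the same type and (SH)
  -- identifies them.
  obtain ⟨b', hb', hbt⟩ := hW.exists_strictFrom hpb.1
    (CoxeterSystem.isReduced_append_left _ hr') (CoxeterSystem.isReduced_append_left _ hr)
    (mul_right_cancel hw).symm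
  have := StrictFrom.eq hSH (h.trans (hb'.append_right hpb.2)) (by simpa [RedWord] using hr)
    (by simp [hbt, ht])
  obtain ⟨rfl, h2⟩ := List.append_inj' this rfl
  exact ⟨hb'.symm, by simpa using h2⟩

theorem IsTwoWeyl.exists_path (hW : W.IsTwoWeyl) (x : V) (ω : List S) :
    ∃ l, W.IsPath x l ∧ l.map W.typ = ω := by
  induction ω generalizing x with
  | nil => exact ⟨[], trivial, rfl⟩
  | cons s ω ih =>
    obtain ⟨e, rfl, he⟩ := hW.pw0 x s
    obtain ⟨l, hl, rfl⟩ := ih (W.ter e)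
    exact ⟨e :: l, ⟨he, hl⟩, rfl⟩

/-- Homotopic alternating geodesics of the same type are equal. -/
theorem HomotopicFrom.eq_of_altWord (hW : W.IsTwoWeyl) (hSH : W.PropSH) {s t : S}
    (hst : M.IsFinitePair s t) {n : ℕ} (hn : n ≤ M s t) (h : W.HomotopicFrom x l l')
    (hl : l.map W.typ = altWord s t n) (hl' : l'.map W.typ = altWord s t n) : l = l' := by
  -- Elementary strict homotopies only relate full words p(s,t) and p(t,s). So both galleries are
  -- extended by the same `d` to full length and compared through a third one of type p(t,s).
  obtain ⟨ω, hω⟩ := CoxeterSystem.altWord_prefix s t hn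
  obtain ⟨d, hd, rfl⟩ := hW.exists_path (W.endpoint x l) ω
  have h1 := h.append_right hd
  have ht : (l ++ d).map W.typ = altWord s t (M s t) := by rw [hω, List.map_append, hl]
  have ht' : (l' ++ d).map W.typ = altWord s t (M s t) := by rw [hω, List.map_append, hl']
  obtain ⟨m, hm, hmt⟩ := hW.exists_strictFrom_altWord hst h1.1 ht
  have h2 := (h1.symm.trans hm.homotopicFrom).strictFrom hst ht' hmt
  have h3 := StrictFrom.eq hSH (hm.trans h2.symm) (by
    rw [RedWord, ht]
    exact CoxeterSystem.isReduced_altWord _ hst.1 (Or.inl le_rfl)) (ht.trans ht'.symm)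
  exact List.append_cancel_right h3

end WeylData

namespace GenChamberSystem

variable {S V E : Type*}

/-! ### Edge calculus in panel groupoids -/

section Edges

variable {W : GenChamberSystem S V E} {i j k : E}

open LabeledGraph

/-- The predicate hides the type and the extremities in existentials; this makes it usable with any
other presentation of the same arrows. -/
theorem IsBacktrack.comp_eq (h : W.IsBacktrack i j) {s : S} {x y : V}
    (hi : W.typ i = s ∧ W.ini i = x ∧ W.ter i = y) (hj : W.typ j = s ∧ W.ini j = y ∧ W.ter j = x) :
    W.comp (PanelHom.ofEdge W.toLabeledGraph i hi) (PanelHom.ofEdge W.toLabeledGraph j hj) =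
      PanelHom.one W.toLabeledGraph s x := by
  obtain ⟨s, x, y, ⟨rfl, rfl, rfl⟩, hj', h⟩ := h
  obtain ⟨rfl, rfl, rfl⟩ := hi
  exact h

theorem IsDetour.comp_eq (h : W.IsDetour i j k) {s : S} {x y z : V}
    (hi : W.typ i = s ∧ W.ini i = x ∧ W.ter i = y) (hj : W.typ j = s ∧ W.ini j = y ∧ W.ter j = z)
    (hk : W.typ k = s ∧ W.ini k = x ∧ W.ter k = z) :
    W.comp (PanelHom.ofEdge W.toLabeledGraph i hi) (PanelHom.ofEdge W.toLabeledGraph j hj) =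
      PanelHom.ofEdge W.toLabeledGraph k hk := by
  obtain ⟨s, x, y, z, ⟨rfl, rfl, rfl⟩, ⟨h1, h2, rfl⟩, hk', h⟩ := h
  obtain ⟨rfl, rfl, rfl⟩ := hi
  obtain ⟨h1, h2, rfl⟩ := hj
  exact h

theorem IsBacktrack.incidence (h : W.IsBacktrack i j) :
    W.typ j = W.typ i ∧ W.ini j = W.ter i ∧ W.ter j = W.ini i := by
  obtain ⟨s, x, y, ⟨rfl, rfl, rfl⟩, hj, -⟩ := h
  exact hj

theorem IsDetour.incidence (h : W.IsDetour i j k) :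
    (W.typ j = W.typ i ∧ W.ini j = W.ter i) ∧
      W.typ k = W.typ i ∧ W.ini k = W.ini i ∧ W.ter k = W.ter j := by
  obtain ⟨s, x, y, z, ⟨rfl, rfl, rfl⟩, ⟨h1, h2, rfl⟩, hk, -⟩ := h
  exact ⟨⟨h1, h2⟩, hk⟩

theorem isBacktrack_of_comp_eq_inl {s : S} {x y z : V}
    {hi : W.typ i = s ∧ W.ini i = x ∧ W.ter i = y} {hj : W.typ j = s ∧ W.ini j = y ∧ W.ter j = z}
    {e : PLift (x = z)} (h : W.comp (Sum.inr ⟨i, hi⟩) (Sum.inr ⟨j, hj⟩) = Sum.inl e) :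
    W.IsBacktrack i j := by
  obtain ⟨rfl⟩ := e
  exact ⟨_, _, _, hi, hj, h⟩

theorem isBacktrack_or_exists_isDetour (ht : W.typ j = W.typ i) (h : W.ini j = W.ter i) :
    W.IsBacktrack i j ∨ ∃ k, W.IsDetour i j k := by
  have hi : W.typ i = W.typ i ∧ W.ini i = W.ini i ∧ W.ter i = W.ter i := ⟨rfl, rfl, rfl⟩
  have hj : W.typ j = W.typ i ∧ W.ini j = W.ter i ∧ W.ter j = W.ter j := ⟨ht, h, rfl⟩
  rcases hc : W.comp (PanelHom.ofEdge W.toLabeledGraph i hi)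
    (PanelHom.ofEdge W.toLabeledGraph j hj) with ⟨⟨e⟩⟩ | ⟨k, hk⟩
  · exact Or.inl (isBacktrack_of_comp_eq_inl hc)
  · exact Or.inr ⟨k, _, _, _, _, hi, hj, hk, hc⟩

theorem IsBacktrack.not_isDetour (h : W.IsBacktrack i j) : ¬ W.IsDetour i j k := by
  rintro ⟨s, x, y, z, hi, hj, hk, hc⟩
  obtain rfl : x = z := by rw [← hj.2.2, h.incidence.2.2, hi.2.1]
  rw [h.comp_eq hi hj] at hc
  exact Sum.inl_ne_inr hc

theorem IsDetour.unique {k' : E} (h : W.IsDetour i j k) (h' : W.IsDetour i j k') : k = k' := by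
  obtain ⟨s, x, y, z, hi, hj, hk, hc⟩ := h
  have hi' := h'.incidence
  rw [h'.comp_eq hi hj ⟨hi'.2.1.trans hi.1, hi'.2.2.1.trans hi.2.1, hi'.2.2.2.trans hj.2.2⟩] at hc
  exact (congrArg Subtype.val (Sum.inr_injective hc)).symm

theorem inv_one (s : S) (x : V) :
    W.inv (PanelHom.one W.toLabeledGraph s x) = PanelHom.one W.toLabeledGraph s x := by
  rw [← W.comp_one (W.inv _), W.inv_comp]

theorem eq_inv_of_comp_eq_one {s : S} {x y : V} {f : W.PanelHom s x y} {g : W.PanelHom s y x}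
    (h : W.comp f g = PanelHom.one W.toLabeledGraph s x) : g = W.inv f := by
  rw [← W.one_comp g, ← W.inv_comp f, W.assoc, h, W.comp_one]

theorem exists_inv_eq {s : S} {x y : V} (hi : W.typ i = s ∧ W.ini i = x ∧ W.ter i = y) :
    ∃ (j : E) (hj : W.typ j = s ∧ W.ini j = y ∧ W.ter j = x),
      W.inv (Sum.inr ⟨i, hi⟩) = Sum.inr ⟨j, hj⟩ ∧ W.IsBacktrack i j := by
  have h := W.comp_inv (PanelHom.ofEdge W.toLabeledGraph i hi)
  rcases hg : W.inv (PanelHom.ofEdge W.toLabeledGraph i hi) with ⟨⟨e⟩⟩ | ⟨j, hj⟩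
  · subst e
    rw [hg] at h
    exact absurd ((W.comp_one _).symm.trans h) Sum.inr_ne_inl
  · rw [hg] at h
    exact ⟨j, hj, hg, _, _, _, hi, hj, h⟩

variable (W) in
theorem exists_isBacktrack (i : E) : ∃ j, W.IsBacktrack i j :=
  let ⟨j, _, _, h⟩ := exists_inv_eq (W := W) (i := i) ⟨rfl, rfl, rfl⟩
  ⟨j, h⟩

end Edges

open LabeledGraph in
/-- A generalized chamber system is determined by its graph, backtracks, and detours. -/
theorem ext_of_isBacktrack_of_isDetour {G G' : GenChamberSystem S V E}
    (h : G.toLabeledGraph = G'.toLabeledGraph)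
    (hb : ∀ i j, G.IsBacktrack i j → G'.IsBacktrack i j)
    (hd : ∀ i j k, G.IsDetour i j k → G'.IsDetour i j k) : G = G' := by
  -- The arrow types depend on the graph, hence `HEq`. Once the compositions agree, the inverses do
  -- so automatically.
  have hcomp : ∀ (s : S) (x y z : V) (f : G.PanelHom s x y) (g : G.PanelHom s y z),
      HEq (G.comp f g) (G'.comp (h ▸ f) (h ▸ g)) := by
    obtain ⟨L, comp, inv, h1, h2, h3, h4, h5⟩ := G
    obtain ⟨L', comp', inv', h1', h2', h3', h4', h5'⟩ := G'
    obtain rfl : L = L' := h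
    intro s x y z f g
    refine heq_of_eq ?_
    change comp f g = comp' f g
    rcases f with ⟨⟨rfl⟩⟩ | ⟨i, hi⟩
    · exact (h1 g).trans (h1' g).symm
    rcases g with ⟨⟨rfl⟩⟩ | ⟨j, hj⟩
    · exact (h2 _).trans (h2' _).symm
    rcases hc : comp (Sum.inr ⟨i, hi⟩) (Sum.inr ⟨j, hj⟩) with ⟨⟨rfl⟩⟩ | ⟨k, hk⟩
    · exact ((hb i j ⟨s, x, y, hi, hj, hc⟩).comp_eq hi hj).symm
    · exact ((hd i j k ⟨s, x, y, z, hi, hj, hk, hc⟩).comp_eq hi hj hk).symm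
  obtain ⟨L, comp, inv, h1, h2, h3, h4, h5⟩ := G
  obtain ⟨L', comp', inv', h1', h2', h3', h4', h5'⟩ := G'
  obtain rfl : L = L' := h
  have e1 : @comp = @comp' := by
    funext s x y z f g
    exact eq_of_heq (hcomp s x y z f g)
  subst e1
  have e2 : @inv = @inv' := by
    funext s x y f
    exact eq_inv_of_comp_eq_one (W := ⟨L, comp, inv', h1', h2', h3', h4', h5'⟩) (h5 f)
  subst e2
  rfl

/-! ### The chamber system of an action -/

section Action

open LabeledGraph

variable {X : Type*} (W : GenChamberSystem S V E) (fin : X → V) (act : X → E → X)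

/-- An action of the panel groupoids of `W` on a set `X` over the chambers. -/
structure IsPanelAction : Prop where
  fin_act : ∀ a e, W.ini e = fin a → fin (act a e) = W.ter e
  backtrack : ∀ a i j, W.ini i = fin a → W.IsBacktrack i j → act (act a i) j = a
  detour : ∀ a i j k, W.ini i = fin a → W.IsDetour i j k → act (act a i) j = act a k

/-- The graph of an action. -/
def actionGraph : LabeledGraph S X {x : X × E // W.ini x.2 = fin x.1} where
  ini x := x.1.1
  ter x := act x.1.1 x.1.2
  typ x := W.typ x.1.2

variable {W fin act}

/-- The relation that the panel arrow `f` sends `a` to `b`. -/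
def Sends (act : X → E → X) {s : S} {x y : V} (f : W.PanelHom s x y) (a b : X) : Prop :=
  match f with
  | Sum.inl _ => a = b
  | Sum.inr e => act a e.1 = b

namespace IsPanelAction

variable (h : W.IsPanelAction fin act)
include h

/-- The projection of a panel arrow of the action graph. -/
def proj {s : S} {a b : X} (f : (W.actionGraph fin act).PanelHom s a b) :
    W.PanelHom s (fin a) (fin b) :=
  match f with
  | Sum.inl e => Sum.inl ⟨congrArg fin e.down⟩
  | Sum.inr e => Sum.inr ⟨e.1.1.2, e.2.1, e.1.2.trans (congrArg fin e.2.2.1),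
      (h.fin_act _ _ e.1.2).symm.trans (congrArg fin e.2.2.2)⟩

theorem sends_proj {s : S} {a b : X} (f : (W.actionGraph fin act).PanelHom s a b) :
    Sends act (h.proj f) a b := by
  rcases f with ⟨⟨e⟩⟩ | ⟨⟨⟨a', i⟩, hi⟩, h1, rfl, h3⟩
  exacts [e, h3]

/-- An edge of the action graph is determined by its source and its image. Arrows from a to b are
thus the arrows of W that send a to b, and `system` inherits its groupoid laws through this
injection. -/
theorem proj_injective {s : S} {a b : X} :
    Function.Injective (h.proj : (W.actionGraph fin act).PanelHom s a b → _) := by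
  rintro (⟨⟨e⟩⟩ | ⟨⟨⟨a', i⟩, hi⟩, h1, rfl, h3⟩) (⟨⟨e'⟩⟩ | ⟨⟨⟨a'', i'⟩, hi'⟩, h1', h2', h3'⟩) hh
  · rfl
  · exact absurd hh Sum.inl_ne_inr
  · exact absurd hh Sum.inr_ne_inl
  · have : i = i' := congrArg Subtype.val (Sum.inr_injective hh)
    subst this
    obtain rfl : a'' = a' := h2'
    rfl

theorem exists_proj_eq {s : S} {a b : X} (f : W.PanelHom s (fin a) (fin b))
    (hf : Sends act f a b) : ∃ f', h.proj f' = f := by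
  rcases f with ⟨⟨e⟩⟩ | ⟨i, h1, h2, h3⟩
  · obtain rfl : a = b := hf
    exact ⟨Sum.inl ⟨rfl⟩, rfl⟩
  · exact ⟨Sum.inr ⟨⟨(a, i), h2⟩, h1, rfl, hf⟩, rfl⟩

theorem sends_comp {s : S} {a b c : X} {f : W.PanelHom s (fin a) (fin b)}
    {g : W.PanelHom s (fin b) (fin c)} (hf : Sends act f a b) (hg : Sends act g b c) :
    Sends act (W.comp f g) a c := by
  rcases f with ⟨⟨e⟩⟩ | ⟨i, hi⟩
  · obtain rfl : a = b := hf
    have := W.one_comp g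
    rw [PanelHom.one] at this
    rwa [this]
  rcases g with ⟨⟨e⟩⟩ | ⟨j, hj⟩
  · obtain rfl : b = c := hg
    have := W.comp_one (Sum.inr ⟨i, hi⟩ : W.PanelHom s (fin a) (fin b))
    rw [PanelHom.one] at this
    rwa [this]
  obtain rfl : act a i = b := hf
  obtain rfl : act (act a i) j = c := hg
  rcases hc : W.comp (Sum.inr ⟨i, hi⟩) (Sum.inr ⟨j, hj⟩) with ⟨⟨e⟩⟩ | ⟨k, hk⟩
  · exact (h.backtrack _ _ _ hi.2.1 (isBacktrack_of_comp_eq_inl hc)).symm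
  · exact (h.detour _ _ _ _ hi.2.1 ⟨_, _, _, _, hi, hj, hk, hc⟩).symm

theorem sends_inv {s : S} {a b : X} {f : W.PanelHom s (fin a) (fin b)}
    (hf : Sends act f a b) : Sends act (W.inv f) b a := by
  rcases f with ⟨⟨e⟩⟩ | ⟨i, hi⟩
  · obtain rfl : a = b := hf
    have := W.inv_one s (fin a)
    rw [PanelHom.one] at this
    rw [this]
    exact rfl
  obtain rfl : act a i = b := hf
  obtain ⟨j, hj, e, hb⟩ := exists_inv_eq hi
  rw [e]
  exact h.backtrack _ _ _ hi.2.1 hb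

/-- The generalized chamber system of an action. -/
noncomputable def system : GenChamberSystem S X {x : X × E // W.ini x.2 = fin x.1} :=
  have hcomp := fun {s : S} {a b c : X} (f : (W.actionGraph fin act).PanelHom s a b)
    (g : (W.actionGraph fin act).PanelHom s b c) =>
      h.exists_proj_eq _ (h.sends_comp (h.sends_proj f) (h.sends_proj g))
  have hinv := fun {s : S} {a b : X} (f : (W.actionGraph fin act).PanelHom s a b) =>
      h.exists_proj_eq _ (h.sends_inv (h.sends_proj f))
  { toLabeledGraph := W.actionGraph fin act
    comp := fun f g => (hcomp f g).choose
    inv := fun f => (hinv f).choose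
    one_comp := fun f => h.proj_injective ((hcomp _ f).choose_spec.trans (W.one_comp _))
    comp_one := fun f => h.proj_injective ((hcomp f _).choose_spec.trans (W.comp_one _))
    assoc := fun f g k => h.proj_injective <| by
      rw [(hcomp _ _).choose_spec, (hcomp _ _).choose_spec, (hcomp _ _).choose_spec,
        (hcomp _ _).choose_spec, W.assoc]
    inv_comp := fun f => h.proj_injective <| by
      rw [(hcomp _ _).choose_spec, (hinv _).choose_spec, W.inv_comp]
      rfl
    comp_inv := fun f => h.proj_injective <| by
      rw [(hcomp _ _).choose_spec, (hinv _).choose_spec, W.comp_inv]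
      rfl }

theorem proj_comp {s : S} {a b c : X} (f : h.system.PanelHom s a b)
    (g : h.system.PanelHom s b c) :
    h.proj (h.system.comp f g) = W.comp (h.proj f) (h.proj g) :=
  (h.exists_proj_eq _ (h.sends_comp (h.sends_proj f) (h.sends_proj g))).choose_spec

theorem system_isBacktrack_iff (x y : {x : X × E // W.ini x.2 = fin x.1}) :
    h.system.IsBacktrack x y ↔ act x.1.1 x.1.2 = y.1.1 ∧ W.IsBacktrack x.1.2 y.1.2 := by
  constructor
  · rintro ⟨s, a, b, hx, hy, hc⟩
    refine ⟨hx.2.2.trans hy.2.1.symm, ?_⟩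
    have := congrArg h.proj hc
    rw [h.proj_comp] at this
    exact ⟨_, _, _, _, _, this⟩
  · rintro ⟨h1, hb⟩
    refine ⟨W.typ x.1.2, x.1.1, _, ⟨rfl, rfl, rfl⟩, ⟨hb.incidence.1, h1.symm, ?_⟩, ?_⟩
    · change act y.1.1 y.1.2 = x.1.1
      rw [← h1, h.backtrack _ _ _ x.2 hb]
    · apply h.proj_injective
      rw [h.proj_comp]
      exact hb.comp_eq _ _

theorem system_isDetour_iff (x y z : {x : X × E // W.ini x.2 = fin x.1}) :
    h.system.IsDetour x y z ↔
      act x.1.1 x.1.2 = y.1.1 ∧ z.1.1 = x.1.1 ∧ W.IsDetour x.1.2 y.1.2 z.1.2 := by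
  constructor
  · rintro ⟨s, a, b, c, hx, hy, hz, hc⟩
    refine ⟨hx.2.2.trans hy.2.1.symm, hz.2.1.trans hx.2.1.symm, ?_⟩
    have := congrArg h.proj hc
    rw [h.proj_comp] at this
    exact ⟨_, _, _, _, _, _, _, this⟩
  · rintro ⟨h1, h2, hd⟩
    refine ⟨W.typ x.1.2, x.1.1, _, _, ⟨rfl, rfl, rfl⟩, ⟨hd.incidence.1.1, h1.symm, rfl⟩,
      ⟨hd.incidence.2.1, h2, ?_⟩, ?_⟩
    · change act z.1.1 z.1.2 = act y.1.1 y.1.2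
      rw [← h1, h.detour _ _ _ _ x.2 hd, h2]
    · apply h.proj_injective
      rw [h.proj_comp]
      exact hd.comp_eq _ _ _

/-- The projection of the chamber system of an action. -/
def systemHom : Hom h.system W where
  obj := fin
  edge x := x.1.2
  ini_edge x := x.2
  ter_edge x := (h.fin_act _ _ x.2).symm
  typ_edge _ := rfl
  map_backtrack x y hb := ((h.system_isBacktrack_iff x y).1 hb).2
  map_detour x y z hd := ((h.system_isDetour_iff x y z).1 hd).2.2

theorem bijOn_systemHom (a : X) :
    Set.BijOn h.systemHom.edge {e | h.system.ini e = a} {e | W.ini e = h.systemHom.obj a} := by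
  refine ⟨?_, ?_, ?_⟩
  · rintro e rfl
    exact e.2
  · rintro ⟨⟨a, i⟩, hi⟩ rfl ⟨⟨a', i'⟩, hi'⟩ (rfl : a' = a) (rfl : i = i')
    rfl
  · intro e he
    exact ⟨⟨(a, e), he⟩, rfl, rfl⟩

end IsPanelAction

end Action

end GenChamberSystem

/-! ### Panel arrows as galleries of at most one edge -/

/-- The sequence of at most one edge of a panel arrow. -/
def LabeledGraph.PanelHom.toList {S V E : Type*} {G : LabeledGraph S V E} {s : S} {x y : V}
    (f : G.PanelHom s x y) : List E :=
  match f with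
  | Sum.inl _ => []
  | Sum.inr e => [e.1]

theorem LabeledGraph.PanelHom.toList_injective {S V E : Type*} {G : LabeledGraph S V E} {s : S}
    {x y : V} {f g : G.PanelHom s x y} (h : f.toList = g.toList) : f = g := by
  rcases f with ⟨⟨e⟩⟩ | ⟨i, hi⟩ <;> rcases g with ⟨⟨e'⟩⟩ | ⟨j, hj⟩
  · rfl
  · simp [toList] at h
  · simp [toList] at h
  · obtain rfl : i = j := by simpa [toList] using h
    rfl

theorem GenChamberSystem.IsBacktrack.toList_comp {S V E : Type*} {W : GenChamberSystem S V E}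
    {i j : E} (h : W.IsBacktrack i j) {s : S} {x y z : V}
    (hi : W.typ i = s ∧ W.ini i = x ∧ W.ter i = y) (hj : W.typ j = s ∧ W.ini j = y ∧ W.ter j = z) :
    (W.comp (LabeledGraph.PanelHom.ofEdge W.toLabeledGraph i hi)
      (LabeledGraph.PanelHom.ofEdge W.toLabeledGraph j hj)).toList = [] := by
  obtain rfl : x = z := by rw [← hj.2.2, h.incidence.2.2, hi.2.1]
  rw [h.comp_eq hi hj]
  rfl

namespace WeylData

open LabeledGraph

variable {S V E : Type*} {M : CoxeterMatrix S} {W : WeylData M V E} {C : V}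

/-! ### Classes of geodesics -/

/-- The class `a` contains the geodesic with the edges `l`. -/
def IsClass (a : W.ClassFrom C) (l : List E) : Prop :=
  ∃ γ : W.GeodesicFrom C, γ.1.edges = l ∧ γ.cls = a

theorem exists_isClass (a : W.ClassFrom C) : ∃ l, IsClass a l := by
  induction a using Quotient.inductionOn with
  | h γ => exact ⟨_, γ, rfl, rfl⟩

theorem exists_isClass_of_isPath {l : List E} (h : W.IsPath C l) (hr : W.RedWord l) :
    ∃ a : W.ClassFrom C, IsClass a l :=
  ⟨_, ⟨⟨C, l, h⟩, hr, rfl⟩, rfl, rfl⟩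

theorem GeodesicFrom.isClass (γ : W.GeodesicFrom C) : IsClass γ.cls γ.1.edges := ⟨γ, rfl, rfl⟩

namespace IsClass

variable {a b : W.ClassFrom C} {l l' : List E}

theorem isPath (h : IsClass a l) : W.IsPath C l := by
  obtain ⟨⟨⟨x, l, hl⟩, hr, rfl⟩, rfl, rfl⟩ := h
  exact hl

theorem redWord (h : IsClass a l) : W.RedWord l := by
  obtain ⟨⟨⟨x, l, hl⟩, hr, rfl⟩, rfl, rfl⟩ := h
  exact hr

theorem endpoint_eq (h : IsClass a l) : W.endpoint C l = a.finish := by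
  obtain ⟨⟨⟨x, l, hl⟩, hr, rfl⟩, rfl, rfl⟩ := h
  rfl

theorem strictFrom (h : IsClass a l) (h' : IsClass a l') : W.StrictFrom C l l' := by
  obtain ⟨⟨⟨x, l, hl⟩, hr, hx⟩, rfl, rfl⟩ := h
  obtain ⟨⟨⟨x', l', hl'⟩, hr', hx'⟩, rfl, e⟩ := h'
  obtain rfl : x = C := hx
  obtain rfl : x' = x := hx'
  exact ⟨hl, hl', Quotient.exact e.symm⟩

theorem of_strictFrom (h : IsClass a l) (h' : W.StrictFrom C l l') : IsClass a l' := by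
  have hr := h'.redWord h.redWord
  obtain ⟨⟨⟨x, l, hl⟩, hr, rfl⟩, rfl, rfl⟩ := h
  obtain ⟨h1, h2, e⟩ := h'
  exact ⟨⟨⟨x, l', h2⟩, ‹_›, rfl⟩, rfl, Quotient.sound (.symm _ _ e)⟩

theorem eq_of_strictFrom (h : IsClass a l) (h' : IsClass b l') (hs : W.StrictFrom C l l') :
    a = b := by
  obtain ⟨⟨⟨x, l, hl⟩, hr, hx⟩, rfl, rfl⟩ := h
  obtain ⟨⟨⟨x', l', hl'⟩, hr', hx'⟩, rfl, rfl⟩ := h'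
  obtain rfl : x = C := hx
  obtain rfl : x' = x := hx'
  obtain ⟨h1, h2, e⟩ := hs
  exact Quotient.sound e

theorem unique (h : IsClass a l) (h' : IsClass b l) : a = b :=
  h.eq_of_strictFrom h' (.refl h.isPath)

end IsClass

/-! ### The action of panel arrows on classes -/

theorem isPath_toList {s : S} {x y : V} (f : W.PanelHom s x y) : W.IsPath x f.toList := by
  rcases f with ⟨⟨rfl⟩⟩ | ⟨i, rfl, rfl, rfl⟩
  exacts [trivial, ⟨rfl, trivial⟩]

theorem endpoint_toList {s : S} {x y : V} (f : W.PanelHom s x y) : W.endpoint x f.toList = y := by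
  rcases f with ⟨⟨rfl⟩⟩ | ⟨i, rfl, rfl, rfl⟩ <;> rfl

theorem redWord_append_toList {s : S} {l : List E} (hr : W.RedWord l)
    (hd : ¬ M.toCoxeterSystem.IsRightDescent (W.wProd l) s) {x y : V} (f : W.PanelHom s x y) :
    W.RedWord (l ++ f.toList) := by
  rcases f with ⟨⟨rfl⟩⟩ | ⟨i, rfl, rfl, rfl⟩
  · simpa [PanelHom.toList] using hr
  · rw [RedWord, List.map_append]
    exact (CoxeterSystem.isReduced_append_singleton_iff _ hr).2 hd

theorem isRightDescent_wProd_append {l : List E} {i : E} (hr : W.RedWord (l ++ [i])) :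
    M.toCoxeterSystem.IsRightDescent (W.wProd (l ++ [i])) (W.typ i) := by
  rw [RedWord, List.map_append] at hr
  rw [wProd, List.map_append]
  exact CoxeterSystem.isRightDescent_append_singleton _ hr

theorem RedWord.left {l l' : List E} (h : W.RedWord (l ++ l')) : W.RedWord l := by
  rw [RedWord, List.map_append] at h
  exact CoxeterSystem.isReduced_append_left _ h

theorem RedWord.right {l l' : List E} (h : W.RedWord (l ++ l')) : W.RedWord l' := by
  rw [RedWord, List.map_append] at h
  exact CoxeterSystem.isReduced_append_right _ h

/-- If s is a descent, a representative is re-typed to end in s and its last edge is split off as f;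
otherwise f is trivial. -/
theorem IsTwoWeyl.exists_normalForm (hW : W.IsTwoWeyl) (a : W.ClassFrom C) (s : S) {y : V}
    (hy : a.finish = y) :
    ∃ (x : V) (l : List E) (f : W.PanelHom s x y), W.endpoint C l = x ∧
      ¬ M.toCoxeterSystem.IsRightDescent (W.wProd l) s ∧ IsClass a (l ++ f.toList) := by
  obtain ⟨l, hl⟩ := exists_isClass a
  by_cases hd : M.toCoxeterSystem.IsRightDescent (W.wProd l) s
  · obtain ⟨ω, hω, hp⟩ := CoxeterSystem.exists_isReduced_append_singleton _ hd
    obtain ⟨l', hl', ht⟩ := hW.exists_strictFrom hl.isPath hl.redWord hω hp.symm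
    obtain ⟨b, e, rfl, hb, he⟩ := List.map_eq_append_iff.1 ht
    obtain ⟨i, rfl⟩ : ∃ i, e = [i] := by
      rw [← List.length_eq_one_iff]
      simpa using congrArg List.length he
    have hi : W.typ i = s := by simpa using he
    have hcl := hl.of_strictFrom hl'
    have hpath := (W.isPath_append _ _ _).1 hcl.isPath
    refine ⟨_, b, Sum.inr ⟨i, hi, hpath.2.1, ?_⟩, rfl, ?_, hcl⟩
    · rw [← hy, ← hcl.endpoint_eq, endpoint_append]
      rfl
    · rw [wProd, hb, ← CoxeterSystem.isReduced_append_singleton_iff _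
        (CoxeterSystem.isReduced_append_left _ hω)]
      exact hω
  · exact ⟨_, l, Sum.inl ⟨hl.endpoint_eq.trans hy⟩, rfl, hd, by simpa [PanelHom.toList] using hl⟩

/-- Whether f is trivial can be read off the W-length, by whether s is a descent. Two nontrivial
arrows are compared by cancelling the last edge. -/
theorem IsTwoWeyl.normalForm_unique (hW : W.IsTwoWeyl) (hSH : W.PropSH) {a : W.ClassFrom C} {s : S}
    {x x' y : V} {l l' : List E} {f : W.PanelHom s x y} {f' : W.PanelHom s x' y}
    (hd : ¬ M.toCoxeterSystem.IsRightDescent (W.wProd l) s)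
    (hd' : ¬ M.toCoxeterSystem.IsRightDescent (W.wProd l') s) (h : IsClass a (l ++ f.toList))
    (h' : IsClass a (l' ++ f'.toList)) : W.StrictFrom C l l' ∧ f.toList = f'.toList := by
  have hs := h.strictFrom h'
  rcases f with ⟨⟨e⟩⟩ | ⟨i, hi⟩ <;> rcases f' with ⟨⟨e'⟩⟩ | ⟨j, hj⟩
  · simp only [PanelHom.toList, List.append_nil] at hs ⊢
    exact ⟨hs, trivial⟩
  · have := isRightDescent_wProd_append h'.redWord
    rw [hj.1] at this
    change W.StrictFrom C (l ++ []) (l' ++ [j]) at hs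
    rw [← hs.wProd_eq, List.append_nil] at this
    exact absurd this hd
  · have := isRightDescent_wProd_append h.redWord
    rw [hi.1] at this
    change W.StrictFrom C (l ++ [i]) (l' ++ []) at hs
    rw [hs.wProd_eq, List.append_nil] at this
    exact absurd this hd'
  · obtain ⟨h1, rfl⟩ := StrictFrom.of_append_singleton hW hSH hs h.redWord (hi.1.trans hj.1.symm)
    exact ⟨h1, rfl⟩

/-- The panel arrow `g` moves the class `a` to the class `b`. -/
def Moves {s : S} {y z : V} (g : W.PanelHom s y z) (a b : W.ClassFrom C) : Prop :=
  ∃ (x : V) (l : List E) (f : W.PanelHom s x y), W.endpoint C l = x ∧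
    ¬ M.toCoxeterSystem.IsRightDescent (W.wProd l) s ∧ IsClass a (l ++ f.toList) ∧
    IsClass b (l ++ (W.comp f g).toList)

namespace Moves

variable {s : S} {x y z : V} {g : W.PanelHom s x y} {h : W.PanelHom s y z} {a b c : W.ClassFrom C}

theorem exists_moves (hW : W.IsTwoWeyl) (g : W.PanelHom s x y) (ha : a.finish = x) :
    ∃ b, Moves g a b := by
  obtain ⟨x', l, f, rfl, hd, hl⟩ := hW.exists_normalForm a s ha
  obtain ⟨b, hb⟩ := exists_isClass_of_isPath
    ((W.isPath_append _ _ _).2 ⟨((W.isPath_append _ _ _).1 hl.isPath).1,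
      isPath_toList (W.comp f g)⟩) (redWord_append_toList hl.redWord.left hd _)
  exact ⟨b, _, l, f, rfl, hd, hl, hb⟩

theorem finish_left (hg : Moves g a b) : a.finish = x := by
  obtain ⟨x', l, f, rfl, hd, hl, hb⟩ := hg
  rw [← hl.endpoint_eq, endpoint_append, endpoint_toList]

theorem finish_right (hg : Moves g a b) : b.finish = y := by
  obtain ⟨x', l, f, rfl, hd, hl, hb⟩ := hg
  rw [← hb.endpoint_eq, endpoint_append, endpoint_toList]

theorem one (hW : W.IsTwoWeyl) (ha : a.finish = x) :
    Moves (PanelHom.one W.toLabeledGraph s x) a a := by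
  obtain ⟨x', l, f, rfl, hd, hl⟩ := hW.exists_normalForm a s ha
  exact ⟨_, l, f, rfl, hd, hl, by rwa [W.comp_one]⟩

/-- A move only multiplies the arrow f of the normal form, so this is associativity in the panel
groupoid; uniqueness of the normal form matches the two presentations of b. -/
theorem comp (hW : W.IsTwoWeyl) (hSH : W.PropSH) (hg : Moves g a b) (hh : Moves h b c) :
    Moves (W.comp g h) a c := by
  obtain ⟨x', l, f, rfl, hd, hl, hb⟩ := hg
  obtain ⟨x'', l', f', rfl, hd', hb', hc⟩ := hh
  obtain ⟨hs, hf⟩ := hW.normalForm_unique hSH hd' hd hb' hb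
  refine ⟨_, l, f, rfl, hd, hl, ?_⟩
  have he := hs.endpoint_eq
  have hp := hs.append_right (((W.isPath_append _ _ _).1 hc.isPath).2)
  convert hc.of_strictFrom hp using 2
  rw [← W.assoc]
  -- The arrows f and f' have different types until their sources are identified.
  generalize W.endpoint C l' = x' at *
  subst he
  rw [PanelHom.toList_injective hf]

theorem unique (hW : W.IsTwoWeyl) (hSH : W.PropSH) (hg : Moves g a b) (hg' : Moves g a c) :
    b = c := by
  obtain ⟨x', l, f, rfl, hd, hl, hb⟩ := hg
  obtain ⟨x'', l', f', rfl, hd', hl', hc⟩ := hg'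
  obtain ⟨hs, hf⟩ := hW.normalForm_unique hSH hd' hd hl' hl
  have he := hs.endpoint_eq
  have hp := hs.append_right (((W.isPath_append _ _ _).1 hc.isPath).2)
  refine hb.unique ?_
  convert hc.of_strictFrom hp using 2
  generalize W.endpoint C l' = x' at *
  subst he
  rw [PanelHom.toList_injective hf]

end Moves

/-- The terminal class of an edge, as a move by a panel arrow. -/
theorem isTerminal_iff_moves {a b : W.ClassFrom C} {i : E} (ha : W.ini i = a.finish) :
    IsTerminal a i b ↔
      Moves (PanelHom.ofEdge W.toLabeledGraph i ⟨rfl, rfl, rfl⟩) a b := by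
  constructor
  · intro h
    cases h with
    | up γ γi i hs hi =>
      refine ⟨_, γ.1.edges, PanelHom.one _ _ _, γ.isClass.endpoint_eq.trans ha.symm, hs, ?_, ?_⟩
      · simpa [PanelHom.one, PanelHom.toList] using γ.isClass
      · rw [W.one_comp]
        change IsClass _ (_ ++ [i])
        rw [← hi]
        exact γi.isClass
    | downTrivial γ α αj i j hs hj hγ hk =>
      have hcl := αj.isClass
      rw [hγ, hj] at hcl
      have hin := hk.incidence
      have hp := ((W.isPath_append _ _ _).1 hcl.isPath).2
      have hf : W.typ j = W.typ i ∧ W.ini j = W.ini j ∧ W.ter j = W.ini i :=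
        ⟨hin.1.symm, rfl, hin.2.1.symm⟩
      refine ⟨W.ini j, α.1.edges, PanelHom.ofEdge _ j hf, hp.1.symm, ?_, hcl, ?_⟩
      · rw [← hin.1.symm, ← CoxeterSystem.isReduced_append_singleton_iff _ α.isClass.redWord]
        simpa [RedWord] using hcl.redWord
      · rw [hk.toList_comp hf, List.append_nil]
        exact α.isClass
    | down γ α αj αk i j k hs hj hγ hk hαk =>
      have hcl := αj.isClass
      rw [hγ, hj] at hcl
      have hin := hk.incidence
      have hp := ((W.isPath_append _ _ _).1 hcl.isPath).2
      have hf : W.typ j = W.typ i ∧ W.ini j = W.ini j ∧ W.ter j = W.ini i :=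
        ⟨hin.1.1.symm, rfl, hin.1.2.symm⟩
      refine ⟨W.ini j, α.1.edges, PanelHom.ofEdge _ j hf, hp.1.symm, ?_, hcl, ?_⟩
      · rw [hin.1.1, ← CoxeterSystem.isReduced_append_singleton_iff _ α.isClass.redWord]
        simpa [RedWord] using hcl.redWord
      · rw [hk.comp_eq hf ⟨rfl, rfl, rfl⟩ ⟨hin.2.1.trans hin.1.1.symm, hin.2.2⟩]
        change IsClass _ (_ ++ [k])
        rw [← hαk]
        exact αk.isClass
  · rintro ⟨x, l, f, rfl, hd, hl, hb⟩
    have hp := (W.isPath_append _ _ _).1 hl.isPath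
    have hr := hl.redWord.left
    obtain ⟨γ, hγ, rfl⟩ := hl
    obtain ⟨γ', hγ', rfl⟩ := hb
    rcases f with ⟨⟨e⟩⟩ | ⟨j, hj⟩
    · simp only [PanelHom.toList, List.append_nil] at hγ
      subst hγ
      refine .up γ γ' i hd ?_
      rw [hγ']
      have h1 : ∀ {x y : V} (e : x = y) (g : W.PanelHom (W.typ i) y (W.ter i)),
          (W.comp (Sum.inl ⟨e⟩) g).toList = g.toList := by
        rintro x y rfl g
        exact congrArg _ (W.one_comp g)
      rw [h1]
      rfl
    · have hdes : M.toCoxeterSystem.IsRightDescent (W.wLength γ.1) (W.typ i) := by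
        have h1 : γ.1.edges = l ++ [j] := hγ
        have h2 := γ.isClass.redWord
        rw [h1] at h2
        change M.toCoxeterSystem.IsRightDescent (W.wProd γ.1.edges) _
        rw [h1, ← hj.1]
        exact isRightDescent_wProd_append h2
      obtain ⟨α, hα⟩ := exists_isClass_of_isPath hp.1 hr
      obtain ⟨α, rfl, rfl⟩ := hα
      rcases hc : W.comp (Sum.inr ⟨j, hj⟩)
        (PanelHom.ofEdge W.toLabeledGraph i ⟨rfl, rfl, rfl⟩) with ⟨e⟩ | ⟨k, hk⟩
      · rw [hc] at hγ'
        have : γ' = α := Subtype.ext (Gallery.ext (γ'.2.2.trans α.2.2.symm)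
          (hγ'.trans (List.append_nil _)))
        subst this
        exact .downTrivial γ γ' γ i j hdes hγ rfl
          (GenChamberSystem.isBacktrack_of_comp_eq_inl hc)
      · rw [hc] at hγ'
        exact .down γ α γ γ' i j k hdes hγ rfl ⟨_, _, _, _, hj, _, hk, hc⟩ hγ'

/-! ### The chamber system of classes -/

open Classical in
/-- The terminal class of an edge that issues from a class. -/
noncomputable def classAct (a : W.ClassFrom C) (i : E) : W.ClassFrom C :=
  -- The default value `a` is irrelevant: in a 2-Weyl graph a move exists for every edge issuing
  -- from `a.finish`.
  if h : ∃ b, Moves (PanelHom.ofEdge W.toLabeledGraph i ⟨rfl, rfl, rfl⟩) a b then h.choose else a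

theorem moves_classAct (hW : W.IsTwoWeyl) {a : W.ClassFrom C} {i : E} (ha : W.ini i = a.finish)
    {s : S} {x y : V} (hi : W.typ i = s ∧ W.ini i = x ∧ W.ter i = y) :
    Moves (PanelHom.ofEdge W.toLabeledGraph i hi) a (classAct a i) := by
  obtain ⟨rfl, rfl, rfl⟩ := hi
  have h := Moves.exists_moves hW (PanelHom.ofEdge W.toLabeledGraph i ⟨rfl, rfl, rfl⟩) ha.symm
  rw [classAct, dif_pos h]
  exact h.choose_spec

theorem isPanelAction_classAct (hW : W.IsTwoWeyl) (hSH : W.PropSH) :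
    W.IsPanelAction (ClassFrom.finish : W.ClassFrom C → V) classAct where
  fin_act a i h := (moves_classAct hW h ⟨rfl, rfl, rfl⟩).finish_right
  backtrack a i j h hb := by
    obtain ⟨s, x, y, hi, hj, hc⟩ := hb
    have h1 := moves_classAct hW h hi
    have h2 := moves_classAct hW (hj.2.1.trans h1.finish_right.symm) hj
    have h3 := h1.comp hW hSH h2
    rw [hc] at h3
    exact h3.unique hW hSH (.one hW h3.finish_left)
  detour a i j k h hd := by
    obtain ⟨s, x, y, z, hi, hj, hk, hc⟩ := hd
    have h1 := moves_classAct hW h hi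
    have h2 := moves_classAct hW (hj.2.1.trans h1.finish_right.symm) hj
    have h3 := h1.comp hW hSH h2
    rw [hc] at h3
    exact h3.unique hW hSH (moves_classAct hW (hk.2.1.trans h3.finish_left.symm) hk)

theorem isTerminal_iff_classAct (hW : W.IsTwoWeyl) (hSH : W.PropSH) {a b : W.ClassFrom C} {i : E}
    (ha : W.ini i = a.finish) : classAct a i = b ↔ IsTerminal a i b := by
  have h := moves_classAct hW ha ⟨rfl, rfl, rfl⟩
  rw [isTerminal_iff_moves ha]
  constructor
  · rintro rfl
    exact h
  · exact h.unique hW hSH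

/-- The generalized chamber system of strict homotopy classes. -/
noncomputable def classSystem (hW : W.IsTwoWeyl) (hSH : W.PropSH) (C : V) :
    GenChamberSystem S (W.ClassFrom C) (W.EdgeFrom C) :=
  (isPanelAction_classAct hW hSH).system

/-- The prescription fixes the graph and contains every backtrack and detour of the action system;
these determine the groupoids by `ext_of_isBacktrack_of_isDetour`. -/
theorem isStrictHomotopySystem_iff (hW : W.IsTwoWeyl) (hSH : W.PropSH)
    (G : GenChamberSystem S (W.ClassFrom C) (W.EdgeFrom C)) :
    IsStrictHomotopySystem G ↔ G = classSystem hW hSH C := by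
  have hA := isPanelAction_classAct (C := C) hW hSH
  constructor
  · intro h
    have hg : G.toLabeledGraph = (classSystem hW hSH C).toLabeledGraph := by
      have h1 := funext h.ini_eq
      have h2 : G.ter = fun x => classAct x.1.1 x.1.2 := funext fun x =>
        (h.ter_eq_iff x _).2 ((isTerminal_iff_classAct hW hSH x.2).1 rfl)
      have h3 := funext h.typ_eq
      obtain ⟨⟨ini, ter, typ⟩, _⟩ := G
      change ini = _ at h1
      change ter = _ at h2
      change typ = _ at h3
      subst h1 h2 h3
      rfl
    symm
    refine GenChamberSystem.ext_of_isBacktrack_of_isDetour hg.symm ?_ ?_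
    · intro x y hb
      obtain ⟨h1, h2⟩ := (hA.system_isBacktrack_iff x y).1 hb
      exact h.backtrack x y (by rw [hg]; exact h1) h2
    · intro x y z hd
      obtain ⟨h1, h2, h3⟩ := (hA.system_isDetour_iff x y z).1 hd
      exact h.detour x y z (by rw [hg]; exact h1) h2 h3
  · rintro rfl
    exact
      { ini_eq := fun x => rfl
        ter_eq_iff := fun x b => isTerminal_iff_classAct hW hSH x.2
        typ_eq := fun x => rfl
        backtrack := fun x y h1 h2 => (hA.system_isBacktrack_iff x y).2 ⟨h1, h2⟩
        detour := fun x y z h1 h2 h3 => (hA.system_isDetour_iff x y z).2 ⟨h1, h2, h3⟩ }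

end WeylData

/-! ### Étale morphisms -/

namespace GenChamberSystem.Hom

variable {S V E V' E' : Type*} {W' : GenChamberSystem S V' E'} {W : GenChamberSystem S V E}
  {p : Hom W' W}

theorem endpoint_map (p : Hom W' W) (x : V') (l : List E') :
    W.endpoint (p.obj x) (l.map p.edge) = p.obj (W'.endpoint x l) := by
  induction l generalizing x with
  | nil => rfl
  | cons e l ih => exact (congrArg (W.endpoint · _) (p.ter_edge e)).trans (ih _)

theorem typ_map (p : Hom W' W) (l : List E') : (l.map p.edge).map W.typ = l.map W'.typ := by
  simp [Function.comp_def, p.typ_edge]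

/-- In the source, i;j is trivial or an edge, and in the latter case the image would be a detour. -/
theorem isBacktrack_of_map (p : Hom W' W) {i j : E'} (h : W'.ini j = W'.ter i)
    (hb : W.IsBacktrack (p.edge i) (p.edge j)) : W'.IsBacktrack i j := by
  have ht := hb.incidence.1
  rw [p.typ_edge, p.typ_edge] at ht
  refine (isBacktrack_or_exists_isDetour ht h).resolve_right ?_
  rintro ⟨k, hk⟩
  exact hb.not_isDetour (p.map_detour _ _ _ hk)

namespace IsSurjectiveEtale

variable (hp : p.IsSurjectiveEtale)
include hp

theorem edge_inj {i j : E'} (h : W'.ini i = W'.ini j) (he : p.edge i = p.edge j) : i = j :=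
  (hp.1 (W'.ini j)).2.1 h rfl he

theorem exists_edge {x : V'} {i : E} (h : W.ini i = p.obj x) : ∃ i', W'.ini i' = x ∧ p.edge i' = i :=
  (hp.1 x).2.2 h

theorem exists_path {x : V'} {l : List E} (h : W.IsPath (p.obj x) l) :
    ∃ l', W'.IsPath x l' ∧ l'.map p.edge = l := by
  induction l generalizing x with
  | nil => exact ⟨[], trivial, rfl⟩
  | cons i l ih =>
    obtain ⟨i, rfl, rfl⟩ := hp.exists_edge h.1
    obtain ⟨l', h1, rfl⟩ := ih (x := W'.ter i) (by rw [← p.ter_edge]; exact h.2)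
    exact ⟨i :: l', ⟨rfl, h1⟩, rfl⟩

theorem path_unique {x : V'} {l l' : List E'} (h : W'.IsPath x l) (h' : W'.IsPath x l')
    (he : l.map p.edge = l'.map p.edge) : l = l' := by
  induction l generalizing x l' with
  | nil => simpa using he
  | cons i l ih =>
    cases l' with
    | nil => simp at he
    | cons j l' =>
      simp only [List.map_cons, List.cons.injEq] at he
      obtain rfl := hp.edge_inj (h.1.trans h'.1.symm) he.1
      rw [ih h.2 h'.2 he.2]

theorem isDetour {i j k : E'} (h : W'.ini j = W'.ter i) (hk : W'.ini k = W'.ini i)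
    (hd : W.IsDetour (p.edge i) (p.edge j) (p.edge k)) : W'.IsDetour i j k := by
  have ht := hd.incidence.1.1
  rw [p.typ_edge, p.typ_edge] at ht
  rcases isBacktrack_or_exists_isDetour ht h with hb | ⟨k', hk'⟩
  · exact absurd hd (p.map_backtrack _ _ hb).not_isDetour
  · obtain rfl := hp.edge_inj (hk.trans hk'.incidence.2.2.1.symm)
      (hd.unique (p.map_detour _ _ _ hk'))
    exact hk'

end IsSurjectiveEtale

end GenChamberSystem.Hom

/-! ### Homotopy under morphisms and coverings -/

namespace WeylData

variable {S V E V' E' : Type*} {M : CoxeterMatrix S} {W' : WeylData M V' E'} {W : WeylData M V E}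

theorem homotopic_iff {g g' : W.Gallery} :
    W.Homotopic g g' ↔ g.start = g'.start ∧ W.HomotopicFrom g.start g.edges g'.edges := by
  constructor
  · intro h
    obtain ⟨x, l, hl⟩ := g
    obtain ⟨x', l', hl'⟩ := g'
    obtain rfl : x = x' := (W.extremities_of_homotopic h).1
    exact ⟨rfl, hl, hl', h⟩
  · rintro ⟨hs, h⟩
    obtain ⟨x, l, hl⟩ := g
    obtain ⟨x', l', hl'⟩ := g'
    obtain rfl : x = x' := hs
    exact h.2.2

theorem _root_.GenChamberSystem.IsBacktrack.homotopicFrom {i j : E} (h : W.IsBacktrack i j) :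
    W.HomotopicFrom (W.ini i) [i, j] [] :=
  ⟨⟨rfl, h.incidence.2.1, trivial⟩, trivial,
    .rel _ _ (.backtrack _ _ [] [] i j h rfl rfl rfl)⟩

theorem _root_.GenChamberSystem.IsDetour.homotopicFrom {i j k : E} (h : W.IsDetour i j k) :
    W.HomotopicFrom (W.ini i) [i, j] [k] :=
  ⟨⟨rfl, h.incidence.1.2, trivial⟩, ⟨h.incidence.2.2.1, trivial⟩,
    .rel _ _ (.shortcut _ _ [] [] i j k h rfl rfl rfl)⟩

theorem IsSuite.homotopicFrom {s t : S} {θ : W.Gallery} (h : W.IsSuite s t θ) :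
    W.HomotopicFrom θ.start θ.edges [] := by
  obtain ⟨-, g₀, h0, hh⟩ := h
  rw [← h0]
  exact (homotopic_iff.1 hh).2

theorem edges_ne_nil_of_isAltCycle {s t : S} {θ : W.Gallery} (h : W.IsAltCycle M s t θ) :
    θ.edges ≠ [] := by
  intro h0
  have := congrArg List.length h.2.2
  rw [CoxeterSystem.length_altWord] at this
  have := h.1.2
  simp_all [LabeledGraph.Gallery.word]

theorem HomotopicFrom.append_append {x : V} {a l l' b : List E} (h : W.IsPath x (a ++ l ++ b))
    (hl : W.HomotopicFrom (W.endpoint x a) l l') : W.HomotopicFrom x (a ++ l ++ b) (a ++ l' ++ b) := by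
  rw [isPath_append, isPath_append] at h
  exact (hl.append_left h.1.1).append_right h.2

/-- Morphisms of Weyl data preserve homotopy. -/
theorem Hom.homotopicFrom (p : Hom W' W) {x : V'} {l l' : List E'} (h : W'.HomotopicFrom x l l') :
    W.HomotopicFrom (p.obj x) (l.map p.edge) (l'.map p.edge) := by
  suffices ∀ g g' : W'.Gallery, W'.Homotopic g g' →
      W.HomotopicFrom (p.obj g.start) (g.edges.map p.edge) (g'.edges.map p.edge) from
    this _ _ h.2.2
  intro g g' hg
  induction hg with
  | rel g g' r =>
    have hp := g.isPath
    have hp' := p.isPath_map _ _ g.isPath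
    cases r with
    | backtrack l₁ l₂ i j h hs hg hg' =>
      rw [hg] at hp hp'
      rw [hg, hg']
      simp only [List.map_append] at hp' ⊢
      have h1 := (p.map_backtrack _ _ h).homotopicFrom (W := W)
      rw [isPath_append, isPath_append] at hp
      rw [p.ini_edge, hp.1.2.1, ← p.endpoint_map] at h1
      simpa using h1.append_append hp'
    | shortcut l₁ l₂ i j k h hs hg hg' =>
      rw [hg] at hp hp'
      rw [hg, hg']
      simp only [List.map_append] at hp' ⊢
      have h1 := (p.map_detour _ _ _ h).homotopicFrom (W := W)
      rw [isPath_append, isPath_append] at hp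
      rw [p.ini_edge, hp.1.2.1, ← p.endpoint_map] at h1
      simpa using h1.append_append hp'
    | suite l₁ l₂ s t θ h hs hg hg' =>
      rw [hg] at hp hp'
      rw [hg, hg']
      simp only [List.map_append] at hp' ⊢
      have h1 := (p.map_suite _ _ _ h).homotopicFrom
      rw [isPath_append, isPath_append] at hp
      have h2 := W'.start_eq_of_isPath
        (edges_ne_nil_of_isAltCycle (W'.isAltCycle_of_mem s t θ h)) hp.1.2 θ.isPath
      change W.HomotopicFrom (p.obj θ.start) (θ.edges.map p.edge) [] at h1
      rw [← h2, ← p.endpoint_map] at h1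
      simpa using h1.append_append hp'
  | refl g => exact .refl (p.isPath_map _ _ g.isPath)
  | symm g g' r ih => exact (W'.extremities_of_homotopic r).1 ▸ ih.symm
  | trans g g' g'' r r' ih ih' => exact ih.trans ((W'.extremities_of_homotopic r).1 ▸ ih')

/-- Coverings lift homotopies. -/
theorem Hom.IsCovering.homotopicFrom {p : Hom W' W} (hp : p.IsCovering) {x : V'} {l l' : List E'}
    (hl : W'.IsPath x l) (hl' : W'.IsPath x l')
    (h : W.HomotopicFrom (p.obj x) (l.map p.edge) (l'.map p.edge)) : W'.HomotopicFrom x l l' := by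
  suffices ∀ g g' : W.Gallery, W.Homotopic g g' → ∀ (x : V') (l l' : List E'), W'.IsPath x l →
      W'.IsPath x l' → p.obj x = g.start → l.map p.edge = g.edges → l'.map p.edge = g'.edges →
      W'.HomotopicFrom x l l' from this _ _ h.2.2 x l l' hl hl' rfl rfl rfl
  clear! x l l'
  intro g g' hg
  induction hg with
  | rel g g' r =>
    intro x l l' hl hl' hx h1 h2
    -- It suffices to contract l to some lift of g'; unique path lifting identifies that lift with
    -- l'.
    have fin : ∀ m, W'.HomotopicFrom x l m → m.map p.edge = g'.edges →
        W'.HomotopicFrom x l l' := by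
      intro m hm he
      rwa [hp.1.path_unique hl' hm.2.1 (h2.trans he.symm)]
    cases r with
    | backtrack l₁ l₂ i j h hs hg hg' =>
      rw [hg] at h1
      obtain ⟨m, b, rfl, hm, rfl⟩ := List.map_eq_append_iff.1 h1
      obtain ⟨a, c, rfl, rfl, hc⟩ := List.map_eq_append_iff.1 hm
      obtain ⟨i, c₁, rfl, rfl, hc₁⟩ := List.map_eq_cons_iff.1 hc
      obtain ⟨j, c₂, rfl, rfl, hc₂⟩ := List.map_eq_cons_iff.1 hc₁
      obtain rfl := List.map_eq_nil_iff.1 hc₂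
      have hl0 := hl
      rw [isPath_append, isPath_append] at hl0
      have h3 := (p.isBacktrack_of_map hl0.1.2.2.1 h).homotopicFrom (W := W')
      rw [hl0.1.2.1] at h3
      exact fin _ (h3.append_append hl) (by simp [hg'])
    | shortcut l₁ l₂ i j k h hs hg hg' =>
      rw [hg] at h1
      obtain ⟨m, b, rfl, hm, rfl⟩ := List.map_eq_append_iff.1 h1
      obtain ⟨a, c, rfl, rfl, hc⟩ := List.map_eq_append_iff.1 hm
      obtain ⟨i, c₁, rfl, rfl, hc₁⟩ := List.map_eq_cons_iff.1 hc
      obtain ⟨j, c₂, rfl, rfl, hc₂⟩ := List.map_eq_cons_iff.1 hc₁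
      obtain rfl := List.map_eq_nil_iff.1 hc₂
      have hl0 := hl
      rw [isPath_append, isPath_append] at hl0
      obtain ⟨k, hk, rfl⟩ := hp.1.exists_edge (h.incidence.2.2.1.trans (p.ini_edge i))
      have h3 := (hp.1.isDetour hl0.1.2.2.1 hk h).homotopicFrom (W := W')
      rw [hl0.1.2.1] at h3
      exact fin _ (h3.append_append hl) (by simp [hg'])
    | suite l₁ l₂ s t θ h hs hg hg' =>
      have hgp := g.isPath
      rw [hg] at h1 hgp
      obtain ⟨m, b, rfl, hm, rfl⟩ := List.map_eq_append_iff.1 h1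
      obtain ⟨a, c, rfl, rfl, hc⟩ := List.map_eq_append_iff.1 hm
      have hl0 := hl
      rw [isPath_append, isPath_append] at hl0 hgp
      have h4 := W.start_eq_of_isPath
        (edges_ne_nil_of_isAltCycle (W.isAltCycle_of_mem s t θ h)) hgp.1.2 θ.isPath
      rw [← hx, p.endpoint_map] at h4
      have h5 : p.mapGallery ⟨W'.endpoint x a, c, hl0.1.2⟩ = θ := LabeledGraph.Gallery.ext h4 hc
      have h3 := (hp.2 s t ⟨W'.endpoint x a, c, hl0.1.2⟩ (h5 ▸ h)).homotopicFrom
      exact fin _ (h3.append_append hl) (by simp [hg'])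
  | refl g =>
    intro x l l' hl hl' _ h1 h2
    rw [hp.1.path_unique hl hl' (h1.trans h2.symm)]
    exact .refl hl'
  | symm g g' r ih =>
    intro x l l' hl hl' hx h1 h2
    exact (ih x l' l hl' hl (hx.trans (W.extremities_of_homotopic r).1.symm) h2 h1).symm
  | trans g g' g'' r r' ih ih' =>
    intro x l l' hl hl' hx h1 h2
    have hx' := hx.trans (W.extremities_of_homotopic r).1
    have hg' := g'.isPath
    rw [← hx'] at hg'
    -- The intermediate gallery is lifted too, from the same chamber.
    obtain ⟨m, hm, he⟩ := hp.1.exists_path hg'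
    exact (ih x l m hl hm hx h1 he).trans (ih' x m l' hm hl' hx' he h2)

/-- The source of a covering of a 2-Weyl graph is a 2-Weyl graph. -/
theorem Hom.IsCovering.isTwoWeyl {p : Hom W' W} (hp : p.IsCovering) (hW : W.IsTwoWeyl) :
    W'.IsTwoWeyl where
  pw0 x s := by
    obtain ⟨e, rfl, he⟩ := hW.pw0 (p.obj x) s
    obtain ⟨e, h1, rfl⟩ := hp.1.exists_edge he
    exact ⟨e, (p.typ_edge e).symm, h1⟩
  pw1 s t hst ρ hρ := by
    obtain ⟨ρ₁, h1, h2⟩ := hW.pw1 s t hst (p.mapGallery ρ) ((p.word_mapGallery ρ).trans hρ)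
    obtain ⟨hs, h2⟩ := homotopic_iff.1 h2
    obtain ⟨l, hl, he⟩ := hp.1.exists_path h2.2.1
    refine ⟨⟨_, l, hl⟩, ?_, homotopic_iff.2 ⟨rfl, ?_⟩⟩
    · rw [← h1, LabeledGraph.Gallery.word, LabeledGraph.Gallery.word, ← he, p.typ_map]
    · exact hp.homotopicFrom ρ.isPath hl (by rw [he]; exact h2)
  w2 g g' h h' hh := by
    have key : ∀ g : W'.Gallery, W'.IsAltGeodesic g → W.IsAltGeodesic (p.mapGallery g) := by
      intro g h
      rw [IsAltGeodesic, IsGeodesic, p.word_mapGallery]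
      exact h
    obtain ⟨hs, hf⟩ := homotopic_iff.1 hh
    have := hW.w2 _ _ (key g h) (key g' h')
      (homotopic_iff.2 ⟨congrArg p.obj hs, p.homotopicFrom hf⟩)
    rwa [wLength, wLength, p.word_mapGallery, p.word_mapGallery] at this

theorem completionHom_isCovering {G : GenChamberSystem S V' E'}
    (p : GenChamberSystem.Hom G W.toGenChamberSystem) (hp : IsPreCovering p) :
    (completionHom p hp).IsCovering :=
  ⟨hp.1, fun _ _ _ hg => isSuite_of_mem (completion p hp) hg⟩

end WeylData

namespace WeylData

open LabeledGraph CoxeterSystem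

variable {S V E : Type*} {M : CoxeterMatrix S} {W : WeylData M V E} {C : V}

/-! ### Suites act trivially on classes -/

theorem classAct_up (hW : W.IsTwoWeyl) (hSH : W.PropSH) {a : W.ClassFrom C} {l : List E} {i : E}
    (h : IsClass a l) (hi : W.ini i = a.finish)
    (hd : ¬ M.toCoxeterSystem.IsRightDescent (W.wProd l) (W.typ i)) :
    IsClass (classAct a i) (l ++ [i]) := by
  obtain ⟨b, hb⟩ := exists_isClass_of_isPath (l := l ++ [i])
    ((W.isPath_append _ _ _).2 ⟨h.isPath, hi.trans h.endpoint_eq.symm, trivial⟩)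
    (by
      rw [RedWord, List.map_append]
      exact (isReduced_append_singleton_iff _ h.redWord).2 hd)
  suffices IsTerminal a i b by rwa [(isTerminal_iff_classAct hW hSH hi).2 this]
  obtain ⟨γ, rfl, rfl⟩ := h
  obtain ⟨γ', h', rfl⟩ := hb
  exact .up γ γ' i hd h'

/-- Here r is the edge sequence of the arrow j;i, which treats backtracks and detours together. -/
theorem classAct_down (hW : W.IsTwoWeyl) (hSH : W.PropSH) {a : W.ClassFrom C} {l : List E} {i j : E}
    (h : IsClass a (l ++ [j])) (hi : W.ini i = a.finish) (ht : W.typ i = W.typ j) :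
    ∃ r : List E, W.HomotopicFrom (W.endpoint C l) [j, i] r ∧ IsClass (classAct a i) (l ++ r) ∧
      (r = [] ∨ ∃ k, r = [k] ∧ W.typ k = W.typ j) := by
  have hp := (W.isPath_append _ _ _).1 h.isPath
  have hij : W.ini i = W.ter j := by
    rw [hi, ← h.endpoint_eq, endpoint_append]
    rfl
  have hr := h.redWord
  have hd := isRightDescent_wProd_append hr
  rw [← ht] at hd
  have hin : W.ini j = W.endpoint C l := hp.2.1
  obtain ⟨α, hα⟩ := exists_isClass_of_isPath hp.1 hr.left
  rcases GenChamberSystem.isBacktrack_or_exists_isDetour ht hij with hb | ⟨k, hk⟩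
  · refine ⟨[], hin ▸ hb.homotopicFrom, ?_, Or.inl rfl⟩
    rw [List.append_nil]
    suffices IsTerminal a i α by rwa [(isTerminal_iff_classAct hW hSH hi).2 this]
    obtain ⟨γ, h', rfl⟩ := h
    obtain ⟨α, rfl, rfl⟩ := hα
    refine .downTrivial γ α γ i j ?_ h' rfl hb
    rw [← h'] at hd
    exact hd
  · have htk := hk.incidence.2.1
    obtain ⟨β, hβ⟩ := exists_isClass_of_isPath (C := C) (l := l ++ [k])
      ((W.isPath_append _ _ _).2 ⟨hp.1, hk.incidence.2.2.1.trans hin, trivial⟩)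
      (by simpa [RedWord, htk] using hr)
    refine ⟨[k], hin ▸ hk.homotopicFrom, ?_, Or.inr ⟨k, rfl, htk⟩⟩
    suffices IsTerminal a i β by rwa [(isTerminal_iff_classAct hW hSH hi).2 this]
    obtain ⟨γ, h', rfl⟩ := h
    obtain ⟨α, rfl, rfl⟩ := hα
    obtain ⟨β, hβ', rfl⟩ := hβ
    refine .down γ α γ β i j k ?_ h' rfl hk hβ'
    rw [← h'] at hd
    exact hd

theorem isClass_foldl_classAct (hW : W.IsTwoWeyl) (hSH : W.PropSH) {a : W.ClassFrom C}
    {l : List E} (h : IsClass a l) {m : List E} (hp : W.IsPath C (l ++ m))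
    (hr : W.RedWord (l ++ m)) : IsClass (m.foldl classAct a) (l ++ m) := by
  induction m generalizing a l with
  | nil => simpa using h
  | cons i m ih =>
    rw [← List.singleton_append, ← List.append_assoc] at hp hr ⊢
    refine ih (classAct_up hW hSH h ?_ ?_) hp hr
    · rw [isPath_append, isPath_append, h.endpoint_eq] at hp
      exact hp.1.2.1
    · have := hr.left
      rw [RedWord, List.map_append] at this
      exact (isReduced_append_singleton_iff _ h.redWord).1 this

/-- A right descent in `{s, t}` can be realized by the last letter of a strictly homotopic
alternating tail. -/
theorem exists_strictFrom_ending (hW : W.IsTwoWeyl) {s t : S}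
    (hst : M.IsFinitePair s t) {η ρ : List E}
    (hs : ¬ M.toCoxeterSystem.IsRightDescent (W.wProd η) s)
    (ht : ¬ M.toCoxeterSystem.IsRightDescent (W.wProd η) t)
    {n : ℕ} (hρ : ρ.map W.typ = alternatingWord s t n) {x : V} (hp : W.IsPath x ρ)
    (hr : W.RedWord (η ++ ρ)) {r : S} (hrst : r = s ∨ r = t)
    (hd : M.toCoxeterSystem.IsRightDescent (W.wProd (η ++ ρ)) r) :
    ∃ (ρ' : List E) (q : S) (m : ℕ), (q = s ∧ r = t ∨ q = t ∧ r = s) ∧ W.StrictFrom x ρ ρ' ∧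
      ρ'.map W.typ = alternatingWord q r (m + 1) := by
  have hn : n ≠ 0 := by
    rintro rfl
    rw [alternatingWord, List.map_eq_nil_iff] at hρ
    subst hρ
    rw [List.append_nil] at hd
    rcases hrst with rfl | rfl
    exacts [hs hd, ht hd]
  rcases hrst with rfl | rfl
  -- The tail ends in `t`, so the other descent forces its length to be exactly m, and a braid move
  -- makes it end in `r`. In the remaining case it already ends in `r`.
  · rw [RedWord, List.map_append, hρ] at hr
    rw [wProd, List.map_append, hρ] at hd
    have h1 := le_of_isRightDescent_append_alternatingWord _ hst.1 hs ht hn hr hd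
    have h2 : n ≤ M r t := by
      by_contra hlt
      exact not_isReduced_alternatingWord _ _ _ hst.2 (not_le.1 hlt) (isReduced_append_right _ hr)
    obtain rfl : n = M r t := le_antisymm h2 h1
    have hst' : M.IsFinitePair t r := ⟨hst.1.symm, by rw [M.symmetric t r]; exact hst.2⟩
    have hb := braidMove_alternatingWord hst' []
    rw [List.nil_append, List.nil_append, ← hρ] at hb
    obtain ⟨ρ', h3, h4⟩ := hW.exists_strictFrom_braidMove hp hb
    obtain ⟨m, hm⟩ := Nat.exists_eq_succ_of_ne_zero hst'.2
    exact ⟨ρ', t, m, Or.inr ⟨rfl, rfl⟩, h3, by rw [← Nat.succ_eq_add_one, ← hm]; exact h4⟩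
  · obtain ⟨m, rfl⟩ := Nat.exists_eq_succ_of_ne_zero hn
    exact ⟨ρ, s, m, Or.inl ⟨rfl, rfl⟩, .refl hp, hρ⟩

/-- If `η` has no right descents in `{s, t}`, then an `{s,t}`-gallery moves `[η]` to `[ηρ']` for an
alternating geodesic `ρ'` homotopic to the gallery. -/
theorem exists_isClass_foldl (hW : W.IsTwoWeyl) (hSH : W.PropSH) {s t : S}
    (hst : M.IsFinitePair s t) {c : W.ClassFrom C} {η : List E} (hη : IsClass c η)
    (hs : ¬ M.toCoxeterSystem.IsRightDescent (W.wProd η) s)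
    (ht : ¬ M.toCoxeterSystem.IsRightDescent (W.wProd η) t) (ρ : List E)
    (hp : W.IsPath (W.endpoint C η) ρ) (hρ : ∀ i ∈ ρ, W.typ i = s ∨ W.typ i = t) :
    ∃ (ρ' : List E) (a b : S) (n : ℕ), (a = s ∧ b = t ∨ a = t ∧ b = s) ∧
      W.HomotopicFrom (W.endpoint C η) ρ ρ' ∧ ρ'.map W.typ = alternatingWord a b n ∧
      IsClass (ρ.foldl classAct c) (η ++ ρ') := by
  induction ρ using List.reverseRecOn with
  | nil => exact ⟨[], s, t, 0, Or.inl ⟨rfl, rfl⟩, .refl trivial, rfl, by simpa using hη⟩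
  | append_singleton ρ i ih =>
    rw [isPath_append] at hp
    obtain ⟨ρ', a, b, n, hab, hh, hw, hc⟩ := ih hp.1 fun i hi => hρ i (List.mem_append_left _ hi)
    have hi : W.typ i = s ∨ W.typ i = t := hρ i (by simp)
    rw [List.foldl_append, List.foldl_cons, List.foldl_nil]
    set d := ρ.foldl classAct c
    have hend : W.ini i = d.finish := by
      rw [← hc.endpoint_eq, endpoint_append, ← hh.endpoint_eq]
      exact hp.2.1
    have hh' := hh.append_right hp.2
    -- At a descent, ρ' is made to end in the type of i and its last edge is composed with i.
    -- Otherwise i is appended, and the type still alternates, since a last letter equal to the type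
    -- of i would be a descent.
    by_cases hd : M.toCoxeterSystem.IsRightDescent (W.wProd (η ++ ρ')) (W.typ i)
    · have hfin : M.IsFinitePair a b := by
        rcases hab with ⟨rfl, rfl⟩ | ⟨rfl, rfl⟩
        exacts [hst, ⟨hst.1.symm, by rw [M.symmetric]; exact hst.2⟩]
      obtain ⟨ρ₁, q, m, hq, hs1, hw1⟩ := exists_strictFrom_ending hW hfin
        (η := η) (by rcases hab with ⟨rfl, rfl⟩ | ⟨rfl, rfl⟩ <;> assumption)
        (by rcases hab with ⟨rfl, rfl⟩ | ⟨rfl, rfl⟩ <;> assumption) hw hh.2.1 hc.redWord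
        (by rcases hab with ⟨rfl, rfl⟩ | ⟨rfl, rfl⟩ <;> tauto) hd
      have hqst : (q = s ∧ W.typ i = t ∨ q = t ∧ W.typ i = s) := by
        rcases hab with ⟨rfl, rfl⟩ | ⟨rfl, rfl⟩
        exacts [hq, hq.symm]
      rw [alternatingWord_succ, List.concat_eq_append] at hw1
      obtain ⟨ρ₂, e, rfl, h2, he⟩ := List.map_eq_append_iff.1 hw1
      obtain ⟨j, rfl⟩ : ∃ j, e = [j] := by
        rw [← List.length_eq_one_iff]
        simpa using congrArg List.length he
      have hj : W.typ j = W.typ i := by simpa using he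
      have hc1 := hc.of_strictFrom (hs1.append_left ((W.isPath_append _ _ _).1 hc.isPath).1)
      rw [← List.append_assoc] at hc1
      obtain ⟨r, hr1, hr2, hr3⟩ := classAct_down hW hSH hc1 hend hj.symm
      have hp2 := (W.isPath_append _ _ _).1 hs1.2.1
      have hh2 : W.HomotopicFrom (W.endpoint C η) (ρ ++ [i]) (ρ₂ ++ r) := by
        have h3 := hs1.homotopicFrom.append_right (b := [i]) (by
          rw [← hh.endpoint_eq]
          exact hp.2)
        rw [endpoint_append] at hr1
        have h4 := hr1.append_left hp2.1
        rw [List.append_assoc] at h3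
        exact (hh'.trans h3).trans h4
      rw [List.append_assoc] at hr2
      rcases hr3 with rfl | ⟨k, rfl, hk⟩
      · exact ⟨ρ₂ ++ [], W.typ i, q, m, by tauto, hh2, by simpa using h2, hr2⟩
      · exact ⟨ρ₂ ++ [k], q, W.typ i, m + 1, hqst, hh2, by
          rw [alternatingWord_succ, List.concat_eq_append, List.map_append, h2, ← hj, ← hk]
          rfl, hr2⟩
    · have hc2 := classAct_up hW hSH hc hend hd
      rw [List.append_assoc] at hc2
      by_cases hib : n ≠ 0 ∧ W.typ i = b
      · obtain ⟨n, rfl⟩ := Nat.exists_eq_succ_of_ne_zero hib.1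
        have hr := hc.redWord
        rw [RedWord, List.map_append, hw, alternatingWord_succ, List.concat_eq_append,
          ← List.append_assoc] at hr
        have := isRightDescent_append_singleton _ hr
        rw [wProd, List.map_append, hw, alternatingWord_succ, List.concat_eq_append,
          ← List.append_assoc, hib.2] at hd
        exact absurd this hd
      · by_cases hn : n = 0
        · subst hn
          rw [alternatingWord, List.map_eq_nil_iff] at hw
          subst hw
          rcases hi with hi | hi
          · exact ⟨[i], t, s, 1, Or.inr ⟨rfl, rfl⟩, hh', by simp [alternatingWord, hi], hc2⟩
          · exact ⟨[i], s, t, 1, Or.inl ⟨rfl, rfl⟩, hh', by simp [alternatingWord, hi], hc2⟩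
        · have hia : W.typ i = a := by
            rcases hab with ⟨rfl, rfl⟩ | ⟨rfl, rfl⟩ <;> tauto
          refine ⟨ρ' ++ [i], b, a, n + 1, by tauto, hh', ?_, hc2⟩
          rw [alternatingWord_succ, List.concat_eq_append, List.map_append, hw, ← hia]
          rfl

/-- With a = [ηβ] and c = [η], the gallery βθ sends c to [ηρ] for an alternating geodesic ρ
homotopic to β. Condition `w2` equates their W-lengths; re-typing ρ by the type of β then yields β
itself by `HomotopicFrom.eq_of_altWord`. -/
theorem foldl_classAct_of_homotopicFrom_nil (hW : W.IsTwoWeyl) (hSH : W.PropSH) {s t : S}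
    (hst : M.IsFinitePair s t) (a : W.ClassFrom C) {θ : List E}
    (h : W.HomotopicFrom a.finish θ []) (hθ : ∀ i ∈ θ, W.typ i = s ∨ W.typ i = t) :
    θ.foldl classAct a = a := by
  obtain ⟨l, hl⟩ := exists_isClass a
  obtain ⟨ω, q, r, n, hqr, hω, hp, hs, ht⟩ :=
    exists_append_altWord M.toCoxeterSystem (i := s) (j := t) (W.wProd l)
  obtain ⟨l', hl', hw⟩ := hW.exists_strictFrom hl.isPath hl.redWord hω hp.symm
  obtain ⟨η, β, rfl, rfl, hβ⟩ := List.map_eq_append_iff.1 hw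
  have ha := hl.of_strictFrom hl'
  have hpath := (W.isPath_append _ _ _).1 ha.isPath
  have hfin : M.IsFinitePair q r := by
    rcases hqr with ⟨rfl, rfl⟩ | ⟨rfl, rfl⟩
    exacts [hst, ⟨hst.1.symm, by rw [M.symmetric]; exact hst.2⟩]
  have hfin' : M.IsFinitePair r q := ⟨hfin.1.symm, by rw [M.symmetric]; exact hfin.2⟩
  have hrβ : M.toCoxeterSystem.IsReduced (altWord q r n) := isReduced_append_right _ hω
  have hnM : n ≤ M q r := by
    by_contra hlt
    rw [altWord_eq_ite] at hrβ
    split_ifs at hrβ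
    · exact not_isReduced_alternatingWord _ _ _ hfin.2 (not_le.1 hlt) hrβ
    · exact not_isReduced_alternatingWord _ _ _ hfin'.2
        (by rw [M.symmetric]; exact not_le.1 hlt) hrβ
  obtain ⟨c, hc⟩ := exists_isClass_of_isPath hpath.1 ha.redWord.left
  have hca : β.foldl classAct c = a :=
    (isClass_foldl_classAct hW hSH hc ha.isPath ha.redWord).unique ha
  have hend : W.endpoint (W.endpoint C η) β = a.finish := by
    rw [← endpoint_append, ha.endpoint_eq]
  have hβθ : W.HomotopicFrom (W.endpoint C η) (β ++ θ) β := by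
    have := HomotopicFrom.append_left hpath.2 (hend ▸ h)
    rwa [List.append_nil] at this
  obtain ⟨ρ, u, v, m, huv, hh, hρ, hcl⟩ := exists_isClass_foldl hW hSH hst hc hs ht (β ++ θ) hβθ.1
    (by
      intro i hi
      rcases List.mem_append.1 hi with hi | hi
      · have := mem_altWord (hβ ▸ List.mem_map_of_mem (f := W.typ) hi)
        rcases hqr with ⟨rfl, rfl⟩ | ⟨rfl, rfl⟩ <;> tauto
      · exact hθ i hi)
  rw [List.foldl_append, hca] at hcl
  have hβρ := hβθ.symm.trans hh
  have hprod : W.wProd ρ = W.wProd β := by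
    refine (hW.w2 ⟨_, β, hβρ.1⟩ ⟨_, ρ, hβρ.2.1⟩ ⟨ha.redWord.right, q, r, n, hfin, hβ⟩
      ⟨hcl.redWord.right, ?_⟩ hβρ.2.2).symm
    have hfin'' : M.IsFinitePair u v ∧ M.IsFinitePair v u := by
      rcases hqr with ⟨rfl, rfl⟩ | ⟨rfl, rfl⟩ <;> rcases huv with ⟨rfl, rfl⟩ | ⟨rfl, rfl⟩ <;>
        exact ⟨by assumption, by assumption⟩
    rw [alternatingWord_eq_ite] at hρ
    split_ifs at hρ
    exacts [⟨u, v, m, hfin''.1, hρ⟩, ⟨v, u, m, hfin''.2, hρ⟩]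
  obtain ⟨ρ', h1, h2⟩ := hW.exists_strictFrom hβρ.2.1 hcl.redWord.right hrβ (by
    rw [hprod, wProd, hβ])
  have h3 := HomotopicFrom.eq_of_altWord hW hSH hfin hnM (hβρ.trans h1.homotopicFrom) hβ h2
  subst h3
  exact (hcl.of_strictFrom (h1.append_left hpath.1)).unique ha

end WeylData

/-! ### Connectedness and endpoints of lifted galleries -/

namespace GenChamberSystem

variable {S V E : Type*}

theorem exists_reverse_path (W : GenChamberSystem S V E) (x : V) (l : List E) (h : W.IsPath x l) :
    ∃ g : W.Gallery, g.start = W.endpoint x l ∧ g.finish = x := by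
  induction l generalizing x with
  | nil => exact ⟨⟨x, [], trivial⟩, rfl, rfl⟩
  | cons i l ih =>
    obtain ⟨rfl, h2⟩ := h
    obtain ⟨⟨y, m, hm⟩, hs, hf⟩ := ih _ h2
    obtain ⟨j, hj⟩ := W.exists_isBacktrack i
    change W.endpoint y m = W.ter i at hf
    have key : ∀ (y : V) (m : List E), W.IsPath y m → W.endpoint y m = W.ter i →
        W.IsPath y (m ++ [j]) ∧ W.endpoint y (m ++ [j]) = W.ini i := by
      intro y m hm hf
      induction m generalizing y with
      | nil => exact ⟨⟨hj.incidence.2.1.trans hf.symm, trivial⟩, hj.incidence.2.2⟩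
      | cons e m ih =>
        have := ih _ hm.2 hf
        exact ⟨⟨hm.1, this.1⟩, this.2⟩
    obtain ⟨h3, h4⟩ := key y m hm hf
    exact ⟨⟨y, _, h3⟩, hs, h4⟩

/-- A generalized chamber system is connected if all chambers are joined to a given one. -/
theorem connected_of_base (W : GenChamberSystem S V E) (z : V)
    (h : ∀ x, ∃ l, W.IsPath z l ∧ W.endpoint z l = x) : W.Connected := by
  intro x y
  obtain ⟨l, hl, rfl⟩ := h x
  obtain ⟨m, hm, rfl⟩ := h y
  obtain ⟨⟨x', k, hk⟩, hs, hf⟩ := W.exists_reverse_path z l hl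
  have key : ∀ (x : V) (k : List E), W.IsPath x k → W.endpoint x k = z →
      W.IsPath x (k ++ m) ∧ W.endpoint x (k ++ m) = W.endpoint z m := by
    intro x k hk he
    induction k generalizing x with
    | nil =>
      obtain rfl : x = z := he
      exact ⟨hm, rfl⟩
    | cons e k ih =>
      have := ih _ hk.2 he
      exact ⟨⟨hk.1, this.1⟩, this.2⟩
  obtain ⟨h1, h2⟩ := key x' k hk hf
  exact ⟨⟨x', _, h1⟩, hs, h2⟩

namespace IsPanelAction

variable {W : GenChamberSystem S V E} {X : Type*} {fin : X → V} {act : X → E → X}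
  (h : W.IsPanelAction fin act)
include h

theorem fin_foldl {a : X} {l : List E} (hl : W.IsPath (fin a) l) :
    fin (l.foldl act a) = W.endpoint (fin a) l := by
  induction l generalizing a with
  | nil => rfl
  | cons i l ih =>
    have h1 := h.fin_act a i hl.1
    rw [List.foldl_cons, ih (by rw [h1]; exact hl.2), h1]
    rfl

/-- A gallery issuing from a is closed exactly if its projection, acting edge by edge, fixes a. -/
theorem endpoint_system {a : X} {l : List {x : X × E // W.ini x.2 = fin x.1}}
    (hl : h.system.IsPath a l) :
    h.system.endpoint a l = (l.map h.systemHom.edge).foldl act a := by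
  induction l generalizing a with
  | nil => rfl
  | cons x l ih =>
    obtain ⟨rfl, h2⟩ := hl
    exact ih h2

end IsPanelAction

end GenChamberSystem

namespace WeylData

open LabeledGraph

variable {S : Type u₀} {V : Type u₁} {E : Type u₂} {M : CoxeterMatrix S} {W : WeylData M V E} {C : V}

/-! ### The projection of the chamber system of classes -/

/-- The projection of the chamber system of classes. -/
noncomputable def classHom (hW : W.IsTwoWeyl) (hSH : W.PropSH) (C : V) :
    GenChamberSystem.Hom (classSystem hW hSH C) W.toGenChamberSystem :=
  (isPanelAction_classAct hW hSH).systemHom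

theorem exists_isClass_nil (C : V) : ∃ a : W.ClassFrom C, IsClass a [] :=
  exists_isClass_of_isPath (l := []) trivial (by simp [RedWord, CoxeterSystem.IsReduced])

theorem classHom_isSurjectiveEtale (hconn : W.Connected) (hW : W.IsTwoWeyl) (hSH : W.PropSH) :
    (classHom hW hSH C).IsSurjectiveEtale := by
  refine ⟨(isPanelAction_classAct hW hSH).bijOn_systemHom, fun y => ?_⟩
  obtain ⟨⟨x, l, hl⟩, rfl, rfl⟩ := hconn C y
  obtain ⟨a, ha⟩ := exists_isClass_nil (W := W) x
  have he : a.finish = x := ha.endpoint_eq.symm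
  -- Any gallery from C to y, acting on the class of the empty gallery, yields a class over y.
  refine ⟨l.foldl classAct a, ?_⟩
  have := (isPanelAction_classAct hW hSH).fin_foldl (a := a) (l := l) (by rw [he]; exact hl)
  rw [he] at this
  exact this

theorem classHom_isPreCovering (hconn : W.Connected) (hW : W.IsTwoWeyl) (hSH : W.PropSH) :
    IsPreCovering (classHom hW hSH C) := by
  refine ⟨classHom_isSurjectiveEtale hconn hW hSH, fun s t g hg => ?_⟩
  have h := isSuite_of_mem W hg
  rw [Gallery.IsCycle, Gallery.finish]
  refine Eq.trans ?_ ((isPanelAction_classAct hW hSH).endpoint_system g.isPath).symm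
  symm
  refine foldl_classAct_of_homotopicFrom_nil hW hSH h.1.1 g.start h.homotopicFrom fun i hi => ?_
  have h1 : ((classHom hW hSH C).mapGallery g).word = _ := h.1.2.2
  have h2 : W.typ i ∈ ((classHom hW hSH C).mapGallery g).word := List.mem_map_of_mem hi
  rw [h1] at h2
  exact CoxeterSystem.mem_altWord h2

/-- A geodesic from C, lifted from the class of the empty gallery, ends at its own class. -/
theorem classSystem_connected (hconn : W.Connected) (hW : W.IsTwoWeyl) (hSH : W.PropSH) :
    (classSystem hW hSH C).Connected := by
  obtain ⟨a, ha⟩ := exists_isClass_nil (W := W) C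
  refine GenChamberSystem.connected_of_base _ a fun b => ?_
  obtain ⟨l, hl⟩ := exists_isClass b
  have hp := hl.isPath
  obtain ⟨m, hm, hml⟩ := (classHom_isSurjectiveEtale hconn hW hSH).exists_path (x := a) (l := l) (by
    change W.IsPath a.finish l
    rw [← ha.endpoint_eq]
    exact hp)
  refine ⟨m, hm, ?_⟩
  refine ((isPanelAction_classAct hW hSH).endpoint_system hm).trans ?_
  change (m.map (classHom hW hSH C).edge).foldl classAct a = b
  rw [hml]
  exact (isClass_foldl_classAct hW hSH ha (m := l) hl.isPath hl.redWord).unique hl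

/-! ### Factorization through an arbitrary covering -/

theorem homotopicFrom_toList_append {s : S} {x y z : V} (f : W.PanelHom s x y)
    (g : W.PanelHom s y z) : W.HomotopicFrom x (f.toList ++ g.toList) (W.comp f g).toList := by
  rcases f with ⟨⟨rfl⟩⟩ | ⟨i, hi⟩
  · have : W.comp (Sum.inl ⟨rfl⟩) g = g := W.one_comp g
    rw [this]
    exact .refl (isPath_toList g)
  rcases g with ⟨⟨rfl⟩⟩ | ⟨j, hj⟩
  · have : W.comp (Sum.inr ⟨i, hi⟩) (Sum.inl ⟨rfl⟩) = Sum.inr ⟨i, hi⟩ := W.comp_one _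
    rw [this]
    exact .refl (isPath_toList (Sum.inr ⟨i, hi⟩ : W.PanelHom s x y))
  rcases hc : W.comp (Sum.inr ⟨i, hi⟩) (Sum.inr ⟨j, hj⟩) with e | ⟨k, hk⟩
  · have := (GenChamberSystem.isBacktrack_of_comp_eq_inl hc).homotopicFrom (W := W)
    rw [hi.2.1] at this
    exact this
  · have : W.IsDetour i j k := ⟨_, _, _, _, hi, hj, hk, hc⟩
    have := this.homotopicFrom
    rw [hi.2.1] at this
    exact this

/-- Moves are realized by homotopies of representatives, which coverings can lift. -/
theorem Moves.exists_homotopicFrom {s : S} {y z : V} {g : W.PanelHom s y z} {a b : W.ClassFrom C}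
    (h : Moves g a b) :
    ∃ l l', IsClass a l ∧ IsClass b l' ∧ W.HomotopicFrom C (l ++ g.toList) l' := by
  obtain ⟨x, l, f, rfl, -, ha, hb⟩ := h
  refine ⟨_, _, ha, hb, ?_⟩
  rw [List.append_assoc]
  exact (homotopicFrom_toList_append f g).append_left ((W.isPath_append _ _ _).1 ha.isPath).1

/-- Every covering factors the projection of the chamber system of classes. -/
theorem exists_hom_of_isCovering (hconn : W.Connected) (hW : W.IsTwoWeyl) (hSH : W.PropSH)
    {V'' E'' : Type*} (W'' : WeylData M V'' E'') (p' : Hom W'' W) (hp' : p'.IsCovering) :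
    ∃ μ : Hom (completion _ (classHom_isPreCovering (C := C) hconn hW hSH)) W'',
      (∀ x, p'.obj (μ.obj x) = (classHom hW hSH C).obj x) ∧
      ∀ e, p'.edge (μ.edge e) = (classHom hW hSH C).edge e := by
  -- A chamber c over C is fixed; μ sends [γ] to the endpoint of the lift of γ from c.
  obtain ⟨c, rfl⟩ := hp'.1.2 C
  have hlift : ∀ a : W.ClassFrom (p'.obj c), ∃ l'', W''.IsPath c l'' ∧
      IsClass a (l''.map p'.edge) := by
    intro a
    obtain ⟨l, hl⟩ := exists_isClass a
    obtain ⟨l'', h1, rfl⟩ := hp'.1.exists_path hl.isPath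
    exact ⟨l'', h1, hl⟩
  choose lft hpath hcls using hlift
  -- Strict homotopies lift as homotopies, so the endpoint does not depend on the representative.
  have hend : ∀ {a : W.ClassFrom (p'.obj c)} {l''}, W''.IsPath c l'' →
      IsClass a (l''.map p'.edge) → W''.endpoint c l'' = W''.endpoint c (lft a) := by
    intro a l'' h1 h2
    exact (hp'.homotopicFrom h1 (hpath a) (h2.strictFrom (hcls a)).homotopicFrom).endpoint_eq
  have hobj : ∀ a, p'.obj (W''.endpoint c (lft a)) = a.finish := by
    intro a
    rw [← (hcls a).endpoint_eq, p'.endpoint_map]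
  have hedge : ∀ x : W.EdgeFrom (p'.obj c), ∃ i, W''.ini i = W''.endpoint c (lft x.1.1) ∧
      p'.edge i = x.1.2 := by
    intro x
    exact hp'.1.exists_edge (x.2.trans (hobj _).symm)
  choose edg hini hedg using hedge
  have hter : ∀ x : W.EdgeFrom (p'.obj c),
      W''.ter (edg x) = W''.endpoint c (lft (classAct x.1.1 x.1.2)) := by
    intro x
    obtain ⟨l, l', ha, hb, hh⟩ := (moves_classAct hW x.2 ⟨rfl, rfl, rfl⟩).exists_homotopicFrom
    obtain ⟨m, hm, rfl⟩ := hp'.1.exists_path ha.isPath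
    obtain ⟨m', hm', rfl⟩ := hp'.1.exists_path hb.isPath
    rw [← hend hm' hb]
    have h1 : W''.IsPath c (m ++ [edg x]) :=
      (W''.isPath_append _ _ _).2 ⟨hm, (hini x).trans (hend hm ha).symm, trivial⟩
    have h2 := (hp'.homotopicFrom h1 hm' (by
      rw [List.map_append, List.map_singleton, hedg]
      exact hh)).endpoint_eq
    rw [← h2, endpoint_append]
    rfl
  let μ : GenChamberSystem.Hom (classSystem hW hSH (p'.obj c)) W''.toGenChamberSystem :=
    { obj := fun a => W''.endpoint c (lft a)
      edge := edg
      ini_edge := hini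
      ter_edge := hter
      typ_edge := fun x => by
        rw [← p'.typ_edge, hedg]
        rfl
      map_backtrack := fun x y hb => by
        obtain ⟨h1, h2⟩ := ((isPanelAction_classAct hW hSH).system_isBacktrack_iff x y).1 hb
        refine p'.isBacktrack_of_map ?_ (by rw [hedg, hedg]; exact h2)
        rw [hini, hter, h1]
      map_detour := fun x y z hd => by
        obtain ⟨h1, h2, h3⟩ := ((isPanelAction_classAct hW hSH).system_isDetour_iff x y z).1 hd
        refine hp'.1.isDetour ?_ ?_ (by rw [hedg, hedg, hedg]; exact h3)
        · rw [hini, hter, h1]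
        · rw [hini, hini, h2] }
  refine ⟨⟨μ, fun s t θ hθ => ?_⟩, hobj, hedg⟩
  -- A defining suite of the completion lies over a defining suite of W, and so does its image under
  -- μ; the covering `p'` makes this image a suite.
  refine hp'.2 s t (μ.mapGallery θ) ?_
  have : p'.mapGallery (μ.mapGallery θ) = (classHom hW hSH (p'.obj c)).mapGallery θ := by
    refine Gallery.ext (hobj _) ?_
    change (θ.edges.map edg).map p'.edge = θ.edges.map (classHom hW hSH (p'.obj c)).edge
    rw [List.map_map]
    exact List.map_congr_left fun x _ => hedg x
  exact this ▸ hθ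

end WeylData

/-! ### Assembly of the universal cover -/

theorem mainTheorem3 {S : Type u₀} (M : CoxeterMatrix S)
    {V : Type u₁} {E : Type u₂} (W : WeylData M V E)
    (hconn : W.Connected) (hW : W.IsTwoWeyl) (hSH : W.PropSH) (C : V) :
    -- the strict homotopy classes form a well-defined generalized chamber system
    ∃ G : GenChamberSystem S (W.ClassFrom C) (W.EdgeFrom C),
      (∀ G' : GenChamberSystem S (W.ClassFrom C) (W.EdgeFrom C),
        WeylData.IsStrictHomotopySystem G' ↔ G' = G) ∧
      -- `[γ] ↦ τ(γ)`, `([γ], i) ↦ i` is a pre-covering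
      ∃ p : GenChamberSystem.Hom G W.toGenChamberSystem,
        (∀ a : W.ClassFrom C, p.obj a = a.finish) ∧ (∀ x : W.EdgeFrom C, p.edge x = x.1.2) ∧
        ∃ hp : WeylData.IsPreCovering p,
          -- and it is the universal cover on the completion
          WeylData.IsUniversalCover.{u₀, max u₁ u₂, max u₁ u₂, u₁, u₂, u₃, u₄}
            (WeylData.completionHom p hp) := by
  refine ⟨_, WeylData.isStrictHomotopySystem_iff hW hSH, WeylData.classHom hW hSH C,
    fun _ => rfl, fun _ => rfl, WeylData.classHom_isPreCovering hconn hW hSH, ?_⟩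
  have hcov := WeylData.completionHom_isCovering _
    (WeylData.classHom_isPreCovering (C := C) hconn hW hSH)
  exact
    { source_isTwoWeyl := hcov.isTwoWeyl hW
      target_isTwoWeyl := hW
      connected := WeylData.classSystem_connected hconn hW hSH
      isCovering := hcov
      universal := fun W'' p' _ hp' =>
        WeylData.exists_hom_of_isCovering hconn hW hSH W'' p' hp' }
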